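/- Let $(X,\mathcal B)$ be a measurable space with countably generated $\sigma$-field, $m=(m_x)_{x\in X}$ a random walk on it (a family of probability measures with $x\mapsto m_x(E)$ measurable for every $E\in\mathcal B$), and $\nu$ a $\sigma$-finite measure on $X$ that is reversible for $m$, i.e. $dm_x(y)\,d\nu(x)=dm_y(x)\,d\nu(y)$. Let $p>1$. For every $x\in X$ let $A_x,B_x\subset X$ be sets with $m_x(A_x)>0$, $m_x(B_x)>0$ such that $\{(x,y):y\in A_x\}$ and $\{(x,y):y\in B_x\}$ are measurable in $X\times X$ and $\operatorname{supp}(m_x)=A_x\cup B_x$, in the sense that $m_x(X\setminus(A_x\cup B_x))=0$; the sets $A_x$, $B_x$ may overlap. Put $$K_A(x,y)=\tfrac12\big(\chi_{A_x}(y)+\chi_{A_y}(x)\big),\qquad K_B(x,y)=\tfrac12\big(\chi_{B_x}(y)+\chi_{B_y}(x)\big),\qquad \nabla u(x,y)=u(y)-u(x),$$ let $\nu\otimes m_x$ be the measure $dm_x(y)\,d\nu(x)$ on $X\times X$, and define $\mathcal F_{A,1,m},\mathcal F_{B,p,m}:L^2(X,\nu)\to[0,+\infty]$ by $$\mathcal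 F_{A,1,m}(u)=\frac12\int_{X\times X}|\nabla u|\,K_A\,d(\nu\otimes m_x),\qquad \mathcal F_{B,p,m}(u)=\frac1{2p}\int_{X\times X}|\nabla u|^p\,K_B\,d(\nu\otimes m_x),$$ with value $+\infty$ when the integral is not finite. For $\mathcal F:L^2(X,\nu)\to(-\infty,+\infty]$ the subdifferential $\partial\mathcal F$ is the multivalued operator with $v\in\partial\mathcal F(u)$ if and only if $\mathcal F(u)<+\infty$ and $\mathcal F(w)-\mathcal F(u)\ge\int_X v(w-u)\,d\nu$ for all $w\in L^2(X,\nu)$. Define multivalued operators on $L^2(X,\nu)$ as follows: $v\in\Delta^m_{1,A}u$ if and only if $-v\in\partial\mathcal F_{A,1,m}(u)$; and $v\in\Delta^m_{p,B}u$ if and only if $u,v\in L^2(X,\nu)$, $K_B|\nabla u|^p\in L^1(X\times X,\nu\otimes m_x)$ and, for $\nu$-a.e. $x$, $$v(x)=\operatorname{div}_m\big(K_B|\nabla u|^{p-2}\nabla u\big)(x),\qquad\text{where } \operatorname{div}_m\mathbf z(x)=\frac12\int_X(\mathbf z(x,y)-\mathbf z(y,x))\,dm_x(y).$$ Suppose that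 $\nu(X)<\infty$ or $p\ge2$. Then, as multivalued operators on $L^2(X,\nu)$, $$\partial\big(\mathcal F_{A,1,m}+\mathcal F_{B,p,m}\big)=\partial\mathcal F_{A,1,m}+\partial\mathcal F_{B,p,m}=-\Delta^m_{1,A}-\Delta^m_{p,B}.$$ Moreover, writing $T$ for this operator, its domain $\{u: Tu\ne\emptyset\}$ is dense in $L^2(X,\nu)$, and $T$ is completely accretive: for all $\lambda>0$, $v_1\in Tu_1$, $v_2\in Tu_2$ and every convex lower semicontinuous $j:\mathbb R\to[0,+\infty]$ with $j(0)=0$, $$\int_X j(u_1-u_2)\,d\nu\le\int_X j\big(u_1-u_2+\lambda(v_1-v_2)\big)\,d\nu.$$ -/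

import Mathlib

open MeasureTheory ProbabilityTheory
open scoped NNReal ENNReal Pointwise

namespace RandomWalk

noncomputable section

/-! Multivalued operators on `H` are maps `H → Set H`. With the pointwise operations on sets,
`(S + T) u = {v + w | v ∈ S u, w ∈ T u}` and `(-S) u = {-v | v ∈ S u}`. -/

/-- The domain of a multivalued operator: the points where its value is nonempty. -/
def opDomain {H : Type*} (T : H → Set H) : Set H :=
  {u | (T u).Nonempty}

/-- The subdifferential of `F : H → (-∞, +∞]`: `v ∈ ∂F(u)` iff `F u` is finite and
`F w - F u ≥ (v, w - u)` for all `w`. -/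
def subdifferential {H : Type*} [NormedAddCommGroup H] [InnerProductSpace ℝ H]
    (F : H → EReal) : H → Set H :=
  fun u => {v | F u < ⊤ ∧ ∀ w : H, F u + ((inner ℝ v (w - u) : ℝ) : EReal) ≤ F w}

/-- The class `J₀` of convex, lower semicontinuous `j : ℝ → [0, +∞]` with `j 0 = 0`. -/
def J0 : Set (ℝ → ℝ≥0∞) :=
  {j | ConvexOn ℝ≥0 Set.univ j ∧ LowerSemicontinuous j ∧ j 0 = 0}

variable {X : Type*} [MeasurableSpace X]

/-- The relation `u ≪ v`: `∫ j(u) dν ≤ ∫ j(v) dν` for all `j ∈ J₀`. -/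
def Dominated (ν : Measure X) (u v : X → ℝ) : Prop :=
  ∀ j ∈ J0, ∫⁻ x, j (u x) ∂ν ≤ ∫⁻ x, j (v x) ∂ν

/-- Complete accretivity of a multivalued operator on `L²(X, ν)`. -/
def CompletelyAccretive {ν : Measure X} (T : Lp ℝ 2 ν → Set (Lp ℝ 2 ν)) : Prop :=
  ∀ lam : ℝ, 0 < lam → ∀ u₁ u₂ v₁ v₂ : Lp ℝ 2 ν, v₁ ∈ T u₁ → v₂ ∈ T u₂ →
    Dominated ν (u₁ - u₂ : Lp ℝ 2 ν) (u₁ - u₂ + lam • (v₁ - v₂) : Lp ℝ 2 ν)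

/-- The nonlocal gradient `∇u(x, y) = u(y) - u(x)`. -/
def nonlocalGrad (u : X → ℝ) (x y : X) : ℝ :=
  u y - u x

/-- The `m`-divergence of `z : X × X → ℝ`. -/
def mDiv (m : Kernel X X) (z : X → X → ℝ) (x : X) : ℝ :=
  (1 / 2) * ∫ y, (z x y - z y x) ∂(m x)

open Classical in
/-- The symmetric weight `K_A(x, y) = (χ_{A_x}(y) + χ_{A_y}(x)) / 2`. -/
def symWeight (A : X → Set X) (x y : X) : ℝ :=
  ((if y ∈ A x then 1 else 0) + (if x ∈ A y then 1 else 0)) / 2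

/-- The functional `F_{A,p,m}(u) = (1 / (2p)) ∫ |∇u|^p K_A d(ν ⊗ m_x)` on `L²(X, ν)`, equal to `+∞`
when the integral is not finite. -/
def energy (m : Kernel X X) (ν : Measure X) (A : X → Set X) (p : ℝ) (u : Lp ℝ 2 ν) : EReal :=
  ((ENNReal.ofReal (1 / (2 * p)) *
    ∫⁻ q, ENNReal.ofReal (|nonlocalGrad u q.1 q.2| ^ p * symWeight A q.1 q.2) ∂(ν ⊗ₘ m) :
      ℝ≥0∞) : EReal)

/-- The `m`-`1`-`A`-Laplacian: `v ∈ Δ_{1,A}(u)` iff `-v ∈ ∂F_{A,1,m}(u)`. -/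
def oneLaplacian (m : Kernel X X) (ν : Measure X) (A : X → Set X) : Lp ℝ 2 ν → Set (Lp ℝ 2 ν) :=
  fun u => {v | -v ∈ subdifferential (energy m ν A 1) u}

/-- The `m`-`p`-`B`-Laplacian (`p > 1`): `v ∈ Δ_{p,B}(u)` iff `u, v ∈ L²(X, ν)`, `∇u` is
`p`-integrable for the weight `K_B`, and `v = div_m (K_B |∇u|^(p-2) ∇u)` `ν`-almost everywhere.
The integrability of `K_B |∇u|^p` makes `K_B |∇u|^(p-1)` integrable for `m_x` for `ν`-a.e. `x`,
so the integral in the divergence converges there. -/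
def pLaplacian (m : Kernel X X) (ν : Measure X) (B : X → Set X) (p : ℝ) :
    Lp ℝ 2 ν → Set (Lp ℝ 2 ν) :=
  fun u => {v |
    Integrable (fun q : X × X => symWeight B q.1 q.2 * |nonlocalGrad u q.1 q.2| ^ p) (ν ⊗ₘ m) ∧
    ∀ᵐ x ∂ν, v x = mDiv m (fun x y =>
      symWeight B x y * (|nonlocalGrad u x y| ^ (p - 2) * nonlocalGrad u x y)) x}

end

end RandomWalk

/-!
Write `ρ = ν ⊗ m`; reversibility makes `ρ` symmetric, so an antisymmetric flux `G` on pairs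
satisfies `∫ φ (-∫ G dm_x) dν = ½ ∫ G ∇φ dρ`. Everything is phrased with fluxes: `v` is a
subgradient of the total variation energy `F₁` when `v = -∫ K_A z dm_x` for an antisymmetric
`z ∈ sign(∇u)`, and a subgradient of the `p`-energy `F_p` exactly when
`v = -∫ K_B |∇u|^(p-2) ∇u dm_x`.

*Fluxes give subgradients* (`mem_subdifferential_one_of_flux`,
`mem_subdifferential_of_signedPow_flux`): this is convexity plus integration by parts
(`integral_mul_div`). A flux is only integrable on strips `E × X` with `ν E < ∞`, so the test
function is first truncated near zero and near infinity, which does not increase its gradient.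

*Subgradients give fluxes* (`exists_flux_of_mem_subdifferential`): differentiating the subgradient
inequality of `F₁ + F_p` along test functions bounds a linear functional of `φ` by
`∫_{∇u = 0} K_A |∇φ| dρ`. By Hahn–Banach and Riesz it is integration of `∇φ` against a function with
values in `[-1, 1]`, which completes `∇u / |∇u|` to a selection of `sign(∇u)`. The test functions
are those dominated by a fixed positive `a ∈ L¹` with `a ≤ 1`: their gradients are bounded multiples
of `a(x) + a(y)`, so that the duality takes place in `L²` of a finite measure.

*Sum rule* (`exists_add_of_mem_subdifferential_add`): the flux splits `v` into two divergences, and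
it remains to see that both are in `L²`. The first is bounded by `1`, which suffices if `ν` is
finite. If `p ≥ 2`, then `t^(p-1) ≤ t + t^p` shows that the second is in `L² + L¹`, hence so is
the first, and a bounded function in `L² + L¹` is in `L²`.

*Complete accretivity* (`completelyAccretive_subdifferential_add`): for a nondecreasing
`1`-Lipschitz `q` with `q 0 = 0`, replacing `(u₁, u₂)` by `(u₁ - q(u₁ - u₂), u₂ + q(u₁ - u₂))` does
not increase the total energy, because it moves the two gradients towards each other. Adding the two
subgradient inequalities gives `∫ (v₁ - v₂) q(u₁ - u₂) dν ≥ 0`. The Moreau envelopes of `j ∈ J₀`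
have multiples of such `q` as derivatives, and Fatou's lemma passes from the envelopes to `j`.

*Density* (`dense_opDomain_subdifferential_add`): simple functions are in the domain, since the
explicit fluxes at a bounded function with support of finite measure have divergence in `L²`.
-/

namespace RandomWalk

open Filter Topology

variable {X : Type*} [MeasurableSpace X] {m : Kernel X X} {ν : Measure X}

/-! ### The symmetric measure `ν ⊗ m` on pairs -/

section Symmetric

variable [IsMarkovKernel m] [SigmaFinite ν]

/-- Reversibility says that `ν ⊗ m` is invariant under exchanging the two coordinates. -/
theorem measurePreserving_swap (hrev : m.IsReversible ν) :
    MeasurePreserving (Prod.swap : X × X → X × X) (ν ⊗ₘ m) (ν ⊗ₘ m) := by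
  refine ⟨measurable_swap, ?_⟩
  refine Measure.ext_of_generateFrom_of_iUnion
    (Set.image2 (· ×ˢ ·) {s : Set X | MeasurableSet s} {t : Set X | MeasurableSet t})
    (fun n => spanningSets ν n ×ˢ Set.univ) generateFrom_prod.symm isPiSystem_prod ?_ ?_ ?_ ?_
  · rw [← Set.iUnion_prod_const, iUnion_spanningSets, Set.univ_prod_univ]
  · exact fun n => ⟨_, measurableSet_spanningSets ν n, _, MeasurableSet.univ, rfl⟩
  · intro n
    rw [Measure.map_apply measurable_swap
      ((measurableSet_spanningSets ν n).prod MeasurableSet.univ), Set.preimage_swap_prod,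
      Measure.compProd_apply_prod MeasurableSet.univ (measurableSet_spanningSets ν n),
      hrev MeasurableSet.univ (measurableSet_spanningSets ν n)]
    simpa using (measure_spanningSets_lt_top ν n).ne
  · rintro _ ⟨s, hs, t, ht, rfl⟩
    rw [Measure.map_apply measurable_swap (MeasurableSet.prod hs ht), Set.preimage_swap_prod,
      Measure.compProd_apply_prod ht hs, Measure.compProd_apply_prod hs ht, hrev ht hs]

theorem measurePreserving_fst : MeasurePreserving (Prod.fst : X × X → X) (ν ⊗ₘ m) ν :=
  ⟨measurable_fst, Measure.fst_compProd ν m⟩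

theorem measurePreserving_snd (hrev : m.IsReversible ν) :
    MeasurePreserving (Prod.snd : X × X → X) (ν ⊗ₘ m) ν :=
  measurePreserving_fst.comp (measurePreserving_swap hrev)

theorem integral_swap (hrev : m.IsReversible ν) (f : X × X → ℝ) :
    ∫ q, f q.swap ∂(ν ⊗ₘ m) = ∫ q, f q ∂(ν ⊗ₘ m) :=
  (measurePreserving_swap hrev).integral_comp' (f := MeasurableEquiv.prodComm) f

theorem integrable_swap (hrev : m.IsReversible ν) {f : X × X → ℝ}
    (hf : Integrable f (ν ⊗ₘ m)) : Integrable (fun q => f q.swap) (ν ⊗ₘ m) :=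
  (measurePreserving_swap hrev).integrable_comp_of_integrable hf

theorem integrable_fst {f : X → ℝ} (hf : Integrable f ν) :
    Integrable (fun q : X × X => f q.1) (ν ⊗ₘ m) :=
  (measurePreserving_fst (m := m)).integrable_comp_of_integrable hf

theorem integrable_snd (hrev : m.IsReversible ν) {f : X → ℝ} (hf : Integrable f ν) :
    Integrable (fun q : X × X => f q.2) (ν ⊗ₘ m) :=
  (measurePreserving_snd hrev).integrable_comp_of_integrable hf

theorem integrable_integral {f : X × X → ℝ} (hf : Integrable f (ν ⊗ₘ m)) :
    Integrable (fun x => ∫ y, f (x, y) ∂(m x)) ν := by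
  have h := MeasureTheory.Integrable.integral_compProd (κ := Kernel.const Unit ν)
    (η := Kernel.prodMkLeft Unit m) (a := ()) hf
  simpa using h

theorem integrable_nonlocalGrad (hrev : m.IsReversible ν) {f : X → ℝ} (hf : Integrable f ν) :
    Integrable (fun q : X × X => nonlocalGrad f q.1 q.2) (ν ⊗ₘ m) :=
  (integrable_snd hrev hf).sub (integrable_fst hf)

/-- Functions that agree `ν`-almost everywhere have nonlocal gradients that agree
`ν ⊗ m`-almost everywhere. -/
theorem nonlocalGrad_congr_ae (hrev : m.IsReversible ν) {f g : X → ℝ} (h : f =ᵐ[ν] g) :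
    ∀ᵐ q ∂(ν ⊗ₘ m), nonlocalGrad f q.1 q.2 = nonlocalGrad g q.1 q.2 := by
  filter_upwards [(measurePreserving_fst (m := m)).quasiMeasurePreserving.ae h,
    (measurePreserving_snd hrev).quasiMeasurePreserving.ae h] with q h1 h2
  simp only [nonlocalGrad, h1, h2]

end Symmetric

theorem measurable_nonlocalGrad {f : X → ℝ} (hf : Measurable f) :
    Measurable (fun q : X × X => nonlocalGrad f q.1 q.2) :=
  (hf.comp measurable_snd).sub (hf.comp measurable_fst)

/-- A symmetric measurable weight on pairs with values in `[0, 1]`. -/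
structure IsSymmWeight (K : X → X → ℝ) : Prop where
  measurable : Measurable (fun q : X × X => K q.1 q.2)
  symm : ∀ x y, K x y = K y x
  nonneg : ∀ x y, 0 ≤ K x y
  le_one : ∀ x y, K x y ≤ 1

theorem isSymmWeight_symWeight {A : X → Set X}
    (hA : MeasurableSet {q : X × X | q.2 ∈ A q.1}) : IsSymmWeight (symWeight A) where
  measurable := by
    classical
    have h1 : Measurable (fun q : X × X => if q.2 ∈ A q.1 then (1 : ℝ) else 0) :=
      Measurable.ite hA measurable_const measurable_const
    have h2 : Measurable (fun q : X × X => if q.1 ∈ A q.2 then (1 : ℝ) else 0) :=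
      h1.comp measurable_swap
    convert (h1.add h2).div_const 2 using 2
    simp only [symWeight, Pi.add_apply]
  symm x y := by simp only [symWeight, add_comm]
  nonneg x y := by unfold symWeight; split_ifs <;> norm_num
  le_one x y := by unfold symWeight; split_ifs <;> norm_num

/-! ### Integration by parts -/

/-- The normal contraction `t ↦ t` truncated away from zero at height `ε` and cut off at height
`N`. -/
noncomputable def truncation (ε N t : ℝ) : ℝ :=
  max (-N) (min N (t - max (-ε) (min ε t)))

theorem truncation_sub_le {ε : ℝ} (hε : 0 ≤ ε) (N s t : ℝ) :
    |truncation ε N s - truncation ε N t| ≤ |s - t| := by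
  have h1 : |truncation ε N s - truncation ε N t| ≤
      |(s - max (-ε) (min ε s)) - (t - max (-ε) (min ε t))| := by
    unfold truncation
    refine (abs_max_sub_max_le_max _ _ _ _).trans (max_le (by simp) ?_)
    exact (abs_min_sub_min_le_max _ _ _ _).trans (max_le (by simp) le_rfl)
  refine h1.trans ?_
  rcases le_total s t with h | h <;> rw [abs_le] <;>
    constructor <;> (try rw [abs_of_nonneg (sub_nonneg.2 h)]) <;>
    (try rw [abs_of_nonpos (sub_nonpos.2 h)]) <;> grind

theorem truncation_eq_zero {ε N t : ℝ} (hN : 0 ≤ N) (ht : |t| ≤ ε) : truncation ε N t = 0 := by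
  obtain ⟨h1, h2⟩ := abs_le.1 ht
  simp [truncation, min_eq_right h2, max_eq_right h1, hN]

theorem abs_truncation_le (ε : ℝ) {N : ℝ} (hN : 0 ≤ N) (t : ℝ) : |truncation ε N t| ≤ N := by
  unfold truncation
  rw [abs_le]
  exact ⟨le_max_left _ _, max_le (by linarith) (min_le_left _ _)⟩

theorem abs_truncation_le_abs {ε N : ℝ} (hε : 0 ≤ ε) (hN : 0 ≤ N) (t : ℝ) :
    |truncation ε N t| ≤ |t| := by
  have := truncation_sub_le hε N t 0
  rwa [truncation_eq_zero (t := 0) hN (by simpa using hε), sub_zero, sub_zero] at this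

theorem measurable_truncation (ε N : ℝ) : Measurable (truncation ε N) := by
  unfold truncation; fun_prop

theorem abs_truncation_sub_self_le {ε N t : ℝ} (hε : 0 ≤ ε) (ht : |t| ≤ N) :
    |truncation ε N t - t| ≤ ε := by
  obtain ⟨h1, h2⟩ := abs_le.1 ht
  unfold truncation
  rw [abs_le]
  grind

theorem tendsto_truncation (t : ℝ) :
    Tendsto (fun n : ℕ => truncation (1 / ((n : ℝ) + 1)) ((n : ℝ) + 1) t) atTop (𝓝 t) := by
  rw [tendsto_iff_dist_tendsto_zero]
  refine squeeze_zero' (Eventually.of_forall fun _ => dist_nonneg) ?_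
    tendsto_one_div_add_atTop_nhds_zero_nat
  filter_upwards [eventually_ge_atTop ⌈|t|⌉₊] with n hn
  rw [Real.dist_eq]
  refine abs_truncation_sub_self_le (by positivity) ?_
  have : (|t| : ℝ) ≤ n := (Nat.le_ceil _).trans (by exact_mod_cast hn)
  linarith

section Parts

variable [IsMarkovKernel m] [SigmaFinite ν]

/-- Integration by parts for an antisymmetric flux `G` when `φ G` is integrable. -/
theorem integral_mul_div_of_integrable (hrev : m.IsReversible ν) {G : X → X → ℝ}
    (hanti : ∀ x y, G y x = -G x y) {φ : X → ℝ}
    (hφG : Integrable (fun q : X × X => φ q.1 * G q.1 q.2) (ν ⊗ₘ m)) :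
    ∫ x, φ x * (-∫ y, G x y ∂(m x)) ∂ν
      = 1 / 2 * ∫ q, G q.1 q.2 * nonlocalGrad φ q.1 q.2 ∂(ν ⊗ₘ m) := by
  have h2 : Integrable (fun q : X × X => φ q.2 * G q.1 q.2) (ν ⊗ₘ m) := by
    refine (integrable_swap hrev hφG).neg.congr (Eventually.of_forall fun q => ?_)
    simp [hanti q.1 q.2]
  have h3 : ∫ q, φ q.2 * G q.1 q.2 ∂(ν ⊗ₘ m) = -∫ q, φ q.1 * G q.1 q.2 ∂(ν ⊗ₘ m) := by
    rw [← integral_swap hrev (fun q => φ q.1 * G q.1 q.2), ← integral_neg]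
    refine integral_congr_ae (Eventually.of_forall fun q => ?_)
    simp [hanti q.1 q.2]
  have h4 : ∫ q, G q.1 q.2 * nonlocalGrad φ q.1 q.2 ∂(ν ⊗ₘ m)
      = -2 * ∫ q, φ q.1 * G q.1 q.2 ∂(ν ⊗ₘ m) := by
    have : ∀ q : X × X, G q.1 q.2 * nonlocalGrad φ q.1 q.2
        = φ q.2 * G q.1 q.2 - φ q.1 * G q.1 q.2 := fun q => by
      simp only [nonlocalGrad]; ring
    simp_rw [this]
    rw [integral_sub h2 hφG, h3]; ring
  rw [h4, Measure.integral_compProd hφG]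
  simp_rw [integral_const_mul, mul_neg]
  rw [integral_neg]; ring

/-- Integration by parts for an antisymmetric flux `G` that is only integrable over finite-measure
strips `E × X`, against `φ ∈ L²` such that `G ∇φ` is integrable. Truncation makes `φ` bounded with
support of finite measure without increasing `|∇φ|`. -/
theorem integral_mul_div (hrev : m.IsReversible ν) {G : X → X → ℝ}
    (hGm : Measurable (fun q : X × X => G q.1 q.2)) (hanti : ∀ x y, G y x = -G x y)
    (hloc : ∀ E : Set X, MeasurableSet E → ν E < ∞ →
      IntegrableOn (fun q : X × X => G q.1 q.2) (Prod.fst ⁻¹' E) (ν ⊗ₘ m))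
    {v φ : X → ℝ} (hv : MemLp v 2 ν) (hvG : ∀ᵐ x ∂ν, v x = -∫ y, G x y ∂(m x))
    (hφ : MemLp φ 2 ν) (hφm : Measurable φ)
    (hGφ : Integrable (fun q : X × X => G q.1 q.2 * nonlocalGrad φ q.1 q.2) (ν ⊗ₘ m)) :
    ∫ x, v x * φ x ∂ν = 1 / 2 * ∫ q, G q.1 q.2 * nonlocalGrad φ q.1 q.2 ∂(ν ⊗ₘ m) := by
  set ψ : ℕ → X → ℝ := fun n x => truncation (1 / ((n : ℝ) + 1)) ((n : ℝ) + 1) (φ x) with hψ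
  have hψm : ∀ n, Measurable (ψ n) := fun n => (measurable_truncation _ _).comp hφm
  have hpos : ∀ n : ℕ, (0 : ℝ) ≤ 1 / ((n : ℝ) + 1) := fun n => by positivity
  have hpos' : ∀ n : ℕ, (0 : ℝ) ≤ (n : ℝ) + 1 := fun n => by positivity
  have key : ∀ n, ∫ x, v x * ψ n x ∂ν
      = 1 / 2 * ∫ q, G q.1 q.2 * nonlocalGrad (ψ n) q.1 q.2 ∂(ν ⊗ₘ m) := by
    intro n
    set E : Set X := {x | 1 / ((n : ℝ) + 1) ≤ ‖φ x‖} with hE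
    have hEm : MeasurableSet E := measurableSet_le measurable_const hφm.norm
    have hEfin : ν E < ∞ := by
      have := hφ.meas_ge_lt_top (by norm_num) (by norm_num)
        (ε := ⟨1 / ((n : ℝ) + 1), hpos n⟩) (fun h => by
          have h0 : 1 / ((n : ℝ) + 1) = 0 := congrArg Subtype.val h
          exact (show 1 / ((n : ℝ) + 1) ≠ 0 by positivity) h0)
      exact this
    have hint : Integrable (fun q : X × X => ψ n q.1 * G q.1 q.2) (ν ⊗ₘ m) := by
      have h1 := ((hloc E hEm hEfin).integrable_indicator (measurable_fst hEm)).norm.const_mul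
        ((n : ℝ) + 1)
      refine h1.mono' (((hψm n).comp measurable_fst).mul hGm).aestronglyMeasurable
        (Eventually.of_forall fun q => ?_)
      by_cases hq : q.1 ∈ E
      · rw [Set.indicator_of_mem (by exact hq), norm_mul]
        exact mul_le_mul_of_nonneg_right (abs_truncation_le _ (hpos' n) _) (norm_nonneg _)
      · have : ψ n q.1 = 0 := truncation_eq_zero (hpos' n) (not_le.1 hq).le
        rw [this, zero_mul, norm_zero]
        positivity
    rw [← integral_mul_div_of_integrable hrev hanti hint]
    refine integral_congr_ae ?_
    filter_upwards [hvG] with x hx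
    rw [hx, mul_comm]
  have l1 : Tendsto (fun n => ∫ x, v x * ψ n x ∂ν) atTop (𝓝 (∫ x, v x * φ x ∂ν)) := by
    refine tendsto_integral_of_dominated_convergence (fun x => ‖v x * φ x‖)
      (fun n => hv.1.mul (hψm n).aestronglyMeasurable) (hv.integrable_mul hφ).norm
      (fun n => Eventually.of_forall fun x => ?_) (Eventually.of_forall fun x => ?_)
    · rw [norm_mul, norm_mul]
      exact mul_le_mul_of_nonneg_left (abs_truncation_le_abs (hpos n) (hpos' n) _) (norm_nonneg _)
    · exact (tendsto_truncation _).const_mul _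
  have l2 : Tendsto (fun n => ∫ q, G q.1 q.2 * nonlocalGrad (ψ n) q.1 q.2 ∂(ν ⊗ₘ m)) atTop
      (𝓝 (∫ q, G q.1 q.2 * nonlocalGrad φ q.1 q.2 ∂(ν ⊗ₘ m))) := by
    refine tendsto_integral_of_dominated_convergence _
      (fun n => (hGm.mul (measurable_nonlocalGrad (hψm n))).aestronglyMeasurable) hGφ.norm
      (fun n => Eventually.of_forall fun q => ?_) (Eventually.of_forall fun q => ?_)
    · rw [norm_mul, norm_mul]
      exact mul_le_mul_of_nonneg_left (truncation_sub_le (hpos n) _ _ _) (norm_nonneg _)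
    · exact ((tendsto_truncation _).sub (tendsto_truncation _)).const_mul _
  refine tendsto_nhds_unique l1 ?_
  simp_rw [key]
  exact l2.const_mul _

end Parts

/-! ### The convex functions `|a| ^ p` -/

/-- The function `|a| ^ (p - 2) a`, equal to `0` at `a = 0`. -/
noncomputable def signedPow (p a : ℝ) : ℝ := |a| ^ (p - 2) * a

theorem signedPow_neg (p a : ℝ) : signedPow p (-a) = -signedPow p a := by
  simp [signedPow]

theorem measurable_signedPow (p : ℝ) : Measurable (signedPow p) := by
  unfold signedPow
  exact (measurable_abs.pow_const _).mul measurable_id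

theorem abs_signedPow {p : ℝ} (hp : 1 < p) (a : ℝ) : |signedPow p a| = |a| ^ (p - 1) := by
  unfold signedPow
  rcases eq_or_ne a 0 with rfl | ha
  · simp [Real.zero_rpow (by linarith : p - 1 ≠ 0)]
  · have h : 0 < |a| := abs_pos.2 ha
    rw [abs_mul, abs_of_nonneg (Real.rpow_nonneg h.le _),
      show p - 1 = p - 2 + 1 by ring, Real.rpow_add_one h.ne']

theorem hasDerivAt_abs_rpow' {p : ℝ} (hp : 1 < p) (a : ℝ) :
    HasDerivAt (fun t : ℝ => |t| ^ p) (p * signedPow p a) a := by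
  simpa [signedPow, mul_assoc] using hasDerivAt_abs_rpow a hp

theorem convexOn_abs_rpow {p : ℝ} (hp : 1 ≤ p) :
    ConvexOn ℝ Set.univ (fun t : ℝ => |t| ^ p) := by
  refine ⟨convex_univ, fun x _ y _ a b ha hb hab => ?_⟩
  have h1 : |a • x + b • y| ≤ a * |x| + b * |y| := by
    refine (abs_add_le _ _).trans ?_
    simp [abs_mul, abs_of_nonneg ha, abs_of_nonneg hb]
  refine (Real.rpow_le_rpow (abs_nonneg _) h1 (by linarith)).trans ?_
  exact (convexOn_rpow hp).2 (abs_nonneg x) (abs_nonneg y) ha hb hab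

theorem abs_rpow_tangent {p : ℝ} (hp : 1 < p) (a b : ℝ) :
    |a| ^ p + p * (signedPow p a * (b - a)) ≤ |b| ^ p := by
  have hc := convexOn_abs_rpow hp.le
  have hd := hasDerivAt_abs_rpow' hp a
  rcases lt_trichotomy a b with h | h | h
  · have := hc.le_slope_of_hasDerivAt (Set.mem_univ a) (Set.mem_univ b) h hd
    rw [slope_def_field, le_div_iff₀ (sub_pos.2 h)] at this
    linarith
  · simp [h]
  · have := hc.slope_le_of_hasDerivAt (Set.mem_univ b) (Set.mem_univ a) h hd
    rw [slope_def_field, div_le_iff₀ (sub_pos.2 h)] at this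
    linarith

/-- Moving two points towards each other by the same amount decreases `|a| ^ p + |b| ^ p`. -/
theorem abs_rpow_add_abs_rpow_le {p : ℝ} (hp : 1 ≤ p) {a b c θ : ℝ} (h0 : 0 ≤ θ) (h1 : θ ≤ 1)
    (hc : c = θ * (a - b)) : |a - c| ^ p + |b + c| ^ p ≤ |a| ^ p + |b| ^ p := by
  have h2 := (convexOn_abs_rpow hp).2 (Set.mem_univ a) (Set.mem_univ b) (sub_nonneg.2 h1) h0
    (by ring)
  have h3 := (convexOn_abs_rpow hp).2 (Set.mem_univ a) (Set.mem_univ b) h0 (sub_nonneg.2 h1)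
    (by ring)
  simp only [smul_eq_mul] at h2 h3
  rw [show (1 - θ) * a + θ * b = a - c by rw [hc]; ring] at h2
  rw [show θ * a + (1 - θ) * b = b + c by rw [hc]; ring] at h3
  linarith

theorem abs_rpow_add_le {p : ℝ} (hp : 1 ≤ p) (a b : ℝ) :
    |a + b| ^ p ≤ 2 ^ p * (|a| ^ p + |b| ^ p) := by
  have h := (convexOn_abs_rpow hp).2 (Set.mem_univ a) (Set.mem_univ b)
    (by norm_num : (0 : ℝ) ≤ 1 / 2) (by norm_num : (0 : ℝ) ≤ 1 / 2) (by norm_num)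
  simp only [smul_eq_mul] at h
  have h2 : |a + b| ^ p = 2 ^ p * |1 / 2 * a + 1 / 2 * b| ^ p := by
    rw [← Real.mul_rpow (by norm_num) (abs_nonneg _)]
    congr 1
    rw [← abs_two (α := ℝ), ← abs_mul, abs_two]
    congr 1; ring
  rw [h2]
  refine mul_le_mul_of_nonneg_left ?_ (by positivity)
  have := Real.rpow_nonneg (abs_nonneg a) p
  have := Real.rpow_nonneg (abs_nonneg b) p
  linarith

theorem rpow_sub_one_le {p : ℝ} (hp : 1 < p) {t : ℝ} (ht : 0 ≤ t) : t ^ (p - 1) ≤ 1 + t ^ p := by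
  have := Real.rpow_nonneg ht p
  rcases le_total t 1 with h | h
  · linarith [Real.rpow_le_one ht h (by linarith : 0 ≤ p - 1)]
  · linarith [Real.rpow_le_rpow_of_exponent_le h (by linarith : p - 1 ≤ p)]

theorem rpow_sub_one_le_add {p : ℝ} (hp : 2 ≤ p) {t : ℝ} (ht : 0 ≤ t) :
    t ^ (p - 1) ≤ t + t ^ p := by
  have := Real.rpow_nonneg ht p
  rcases le_total t 1 with h | h
  · rcases ht.eq_or_lt with rfl | h0
    · rw [Real.zero_rpow (by linarith : p - 1 ≠ 0)]; positivity
    · have := Real.rpow_le_rpow_of_exponent_ge h0 h (by linarith : (1 : ℝ) ≤ p - 1)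
      rw [Real.rpow_one] at this
      linarith
  · linarith [Real.rpow_le_rpow_of_exponent_le h (by linarith : p - 1 ≤ p)]

theorem rpow_sub_one_mul_le {p : ℝ} (hp : 1 < p) {s t : ℝ} (hs : 0 ≤ s) (ht : 0 ≤ t) :
    s ^ (p - 1) * t ≤ s ^ p + t ^ p := by
  have h : ∀ r : ℝ, 0 ≤ r → r ^ (p - 1) * r = r ^ p := fun r hr => by
    rcases hr.eq_or_lt with rfl | h0
    · simp [Real.zero_rpow (by linarith : p ≠ 0)]
    · rw [← Real.rpow_add_one h0.ne', sub_add_cancel]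
  have h1 := Real.rpow_nonneg hs p
  have h2 := Real.rpow_nonneg ht p
  rcases le_total t s with hts | hts
  · have := mul_le_mul_of_nonneg_left hts (Real.rpow_nonneg hs (p - 1))
    rw [h s hs] at this
    linarith
  · have := mul_le_mul_of_nonneg_right
      (Real.rpow_le_rpow hs hts (by linarith : 0 ≤ p - 1)) ht
    rw [h t ht] at this
    linarith

theorem rpow_le_mul_of_le {p : ℝ} (hp : 1 ≤ p) {t M : ℝ} (ht : 0 ≤ t) (hM : t ≤ M) :
    t ^ p ≤ M ^ (p - 1) * t := by
  rcases ht.eq_or_lt with rfl | h0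
  · simp [Real.zero_rpow (by linarith : p ≠ 0)]
  · rw [show p = p - 1 + 1 by ring, Real.rpow_add_one h0.ne']
    simp only [add_sub_cancel_right]
    exact mul_le_mul_of_nonneg_right (Real.rpow_le_rpow ht hM (by linarith)) ht

/-! ### Energies and their subdifferentials in real terms -/

/-- The functional `f ↦ (1 / (2p)) ∫ |∇f| ^ p K d(ν ⊗ m)` on functions, for a weight `K` on
pairs. -/
noncomputable def weightedEnergy (m : Kernel X X) (ν : Measure X) (K : X → X → ℝ) (p : ℝ)
    (f : X → ℝ) : ℝ≥0∞ :=
  ENNReal.ofReal (1 / (2 * p)) *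
    ∫⁻ q, ENNReal.ofReal (|nonlocalGrad f q.1 q.2| ^ p * K q.1 q.2) ∂(ν ⊗ₘ m)

theorem weightedEnergy_congr [IsMarkovKernel m] [SigmaFinite ν] (hrev : m.IsReversible ν)
    (K : X → X → ℝ) (p : ℝ) {f g : X → ℝ} (h : f =ᵐ[ν] g) :
    weightedEnergy m ν K p f = weightedEnergy m ν K p g := by
  unfold weightedEnergy
  congr 1
  refine lintegral_congr_ae ?_
  filter_upwards [nonlocalGrad_congr_ae hrev h] with q hq
  rw [hq]

/-- The density `K |∇f| ^ p` of the energy. -/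
noncomputable def energyDensity (K : X → X → ℝ) (p : ℝ) (f : X → ℝ) (q : X × X) : ℝ :=
  K q.1 q.2 * |nonlocalGrad f q.1 q.2| ^ p

theorem IsSymmWeight.energyDensity_nonneg {K : X → X → ℝ} (hK : IsSymmWeight K) (p : ℝ)
    (f : X → ℝ) (q : X × X) : 0 ≤ energyDensity K p f q :=
  mul_nonneg (hK.nonneg _ _) (Real.rpow_nonneg (abs_nonneg _) _)

theorem IsSymmWeight.measurable_energyDensity {K : X → X → ℝ} (hK : IsSymmWeight K) (p : ℝ)
    {f : X → ℝ} (hf : Measurable f) : Measurable (energyDensity K p f) :=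
  hK.measurable.mul ((measurable_nonlocalGrad hf).abs.pow_const p)

theorem weightedEnergy_eq (K : X → X → ℝ) (p : ℝ) (f : X → ℝ) :
    weightedEnergy m ν K p f = ENNReal.ofReal (1 / (2 * p)) *
      ∫⁻ q, ENNReal.ofReal (energyDensity K p f q) ∂(ν ⊗ₘ m) := by
  simp only [weightedEnergy, energyDensity, mul_comm (K _ _)]

theorem weightedEnergy_ne_top_iff {K : X → X → ℝ} (hK : IsSymmWeight K) {p : ℝ} (hp : 0 < p)
    {f : X → ℝ} (hf : Measurable f) :
    weightedEnergy m ν K p f ≠ ∞ ↔ Integrable (energyDensity K p f) (ν ⊗ₘ m) := by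
  rw [weightedEnergy_eq, Integrable,
    hasFiniteIntegral_iff_ofReal (Eventually.of_forall (hK.energyDensity_nonneg p f)),
    and_iff_right (hK.measurable_energyDensity p hf).aestronglyMeasurable, lt_top_iff_ne_top]
  have h0 : ENNReal.ofReal (1 / (2 * p)) ≠ 0 := by
    rw [Ne, ENNReal.ofReal_eq_zero, not_le]; positivity
  refine ⟨fun h h' => h ?_, fun h => ENNReal.mul_ne_top ENNReal.ofReal_ne_top h⟩
  rw [h', ENNReal.mul_top h0]

theorem toReal_weightedEnergy {K : X → X → ℝ} (hK : IsSymmWeight K) {p : ℝ} (hp : 0 < p)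
    {f : X → ℝ} (hf : Measurable f) :
    (weightedEnergy m ν K p f).toReal
      = 1 / (2 * p) * ∫ q, energyDensity K p f q ∂(ν ⊗ₘ m) := by
  rw [weightedEnergy_eq, ENNReal.toReal_mul, ENNReal.toReal_ofReal (by positivity),
    integral_eq_lintegral_of_nonneg_ae (Eventually.of_forall (hK.energyDensity_nonneg p f))
      (hK.measurable_energyDensity p hf).aestronglyMeasurable]

/-- The subdifferential of a functional with values in `[0, +∞]`, tested only where the functional
is finite. -/
theorem mem_subdifferential_coe_iff {H : Type*} [NormedAddCommGroup H] [InnerProductSpace ℝ H]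
    {F : H → ℝ≥0∞} {u v : H} :
    v ∈ subdifferential (fun w => (F w : EReal)) u ↔
      F u ≠ ∞ ∧ ∀ w, F w ≠ ∞ → (F u).toReal + inner ℝ v (w - u) ≤ (F w).toReal := by
  have hcoe : ∀ w, F w ≠ ∞ → (F w : EReal) = ((F w).toReal : EReal) := fun w hw =>
    (EReal.coe_ennreal_toReal hw).symm
  simp only [subdifferential, Set.mem_ofPred_eq]
  have h0 : ((F u : EReal) < ⊤) ↔ F u ≠ ∞ := by
    rw [lt_top_iff_ne_top, Ne, EReal.coe_ennreal_eq_top_iff]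
  rw [h0]
  refine and_congr_right fun hu => forall_congr' fun w => ?_
  by_cases hw : F w = ∞
  · simp [hw]
  · simp only [ne_eq, hw, not_false_eq_true, forall_const]
    rw [hcoe u hu, hcoe w hw, ← EReal.coe_add, EReal.coe_le_coe_iff]

/-- The sum of two subdifferentials lies in the subdifferential of the sum. -/
theorem add_subset_subdifferential_add {H : Type*} [NormedAddCommGroup H] [InnerProductSpace ℝ H]
    {F G : H → ℝ≥0∞} {u v w : H} (hv : v ∈ subdifferential (fun w => (F w : EReal)) u)
    (hw : w ∈ subdifferential (fun w => (G w : EReal)) u) :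
    v + w ∈ subdifferential (fun w => ((F w + G w : ℝ≥0∞) : EReal)) u := by
  rw [mem_subdifferential_coe_iff] at hv hw ⊢
  refine ⟨ENNReal.add_ne_top.2 ⟨hv.1, hw.1⟩, fun x hx => ?_⟩
  obtain ⟨h1, h2⟩ := ENNReal.add_ne_top.1 hx
  rw [ENNReal.toReal_add hv.1 hw.1, ENNReal.toReal_add h1 h2, inner_add_left]
  linarith [hv.2 x h1, hw.2 x h2]

theorem inner_Lp_eq (v w : Lp ℝ 2 ν) : inner ℝ v w = ∫ x, v x * w x ∂ν := by
  rw [L2.inner_def]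
  refine integral_congr_ae (Eventually.of_forall fun x => ?_)
  simp [mul_comm]

/-! ### Fluxes give subgradients -/

section Flux

variable [IsMarkovKernel m] [SigmaFinite ν]

omit [SigmaFinite ν] in
theorem measurable_Lp (u : Lp ℝ 2 ν) : Measurable u := (Lp.stronglyMeasurable u).measurable

theorem integrableOn_strip {G D : X × X → ℝ} (hG : Measurable G)
    (hD : Integrable D (ν ⊗ₘ m)) (hGD : ∀ q, |G q| ≤ 1 + D q) {E : Set X}
    (hE : MeasurableSet E) (hfin : ν E < ∞) :
    IntegrableOn G (Prod.fst ⁻¹' E) (ν ⊗ₘ m) := by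
  have h1 : (ν ⊗ₘ m) (Prod.fst ⁻¹' E) ≠ ∞ := by
    rw [(measurePreserving_fst (m := m) (ν := ν)).measure_preimage hE.nullMeasurableSet]
    exact hfin.ne
  exact ((integrableOn_const (C := (1 : ℝ)) h1).add hD.integrableOn).mono'
    hG.aestronglyMeasurable (Eventually.of_forall hGD)

/-- Integration by parts against a difference of elements of `L²`. -/
theorem inner_sub_eq_of_flux (hrev : m.IsReversible ν) {G : X → X → ℝ}
    (hGm : Measurable (fun q : X × X => G q.1 q.2)) (hanti : ∀ x y, G y x = -G x y)
    {D : X × X → ℝ} (hD : Integrable D (ν ⊗ₘ m)) (hGD : ∀ q, |G q.1 q.2| ≤ 1 + D q)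
    {u v w : Lp ℝ 2 ν} (hv : ∀ᵐ x ∂ν, v x = -∫ y, G x y ∂(m x))
    (hG : Integrable (fun q : X × X =>
      G q.1 q.2 * (nonlocalGrad w q.1 q.2 - nonlocalGrad u q.1 q.2)) (ν ⊗ₘ m)) :
    inner ℝ v (w - u) = 1 / 2 * ∫ q, G q.1 q.2 *
      (nonlocalGrad w q.1 q.2 - nonlocalGrad u q.1 q.2) ∂(ν ⊗ₘ m) := by
  have hgrad : ∀ q : X × X, nonlocalGrad (fun x => w x - u x) q.1 q.2
      = nonlocalGrad w q.1 q.2 - nonlocalGrad u q.1 q.2 := fun q => by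
    simp only [nonlocalGrad]; ring
  have h := integral_mul_div hrev hGm hanti
    (fun E hE hfin => integrableOn_strip hGm hD hGD hE hfin) (Lp.memLp v) hv
    (φ := fun x => w x - u x) ((Lp.memLp w).sub (Lp.memLp u))
    ((measurable_Lp w).sub (measurable_Lp u)) (by simpa only [hgrad] using hG)
  simp only [hgrad] at h
  rw [← h, inner_Lp_eq]
  refine integral_congr_ae ?_
  filter_upwards [Lp.coeFn_sub w u] with x hx
  rw [hx, Pi.sub_apply]

/-- A bounded antisymmetric flux `z ∈ sign(∇u)` whose divergence is in `L²` gives a subgradient of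
the total variation energy. -/
theorem mem_subdifferential_one_of_flux (hrev : m.IsReversible ν) {K : X → X → ℝ}
    (hK : IsSymmWeight K) {u v : Lp ℝ 2 ν} (hu : weightedEnergy m ν K 1 u ≠ ∞) {z : X → X → ℝ}
    (hzm : Measurable (fun q : X × X => z q.1 q.2)) (hanti : ∀ x y, z y x = -z x y)
    (hz : ∀ x y, |z x y| ≤ 1) (hzu : ∀ x y, z x y * nonlocalGrad u x y = |nonlocalGrad u x y|)
    (hv : ∀ᵐ x ∂ν, v x = -∫ y, K x y * z x y ∂(m x)) :
    v ∈ subdifferential (fun w : Lp ℝ 2 ν => (weightedEnergy m ν K 1 w : EReal)) u := by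
  rw [mem_subdifferential_coe_iff]
  refine ⟨hu, fun w hw => ?_⟩
  have hum := measurable_Lp u
  have hwm := measurable_Lp w
  rw [toReal_weightedEnergy hK one_pos hum, toReal_weightedEnergy hK one_pos hwm]
  have hu' := (weightedEnergy_ne_top_iff hK one_pos hum).1 hu
  have hw' := (weightedEnergy_ne_top_iff hK one_pos hwm).1 hw
  have hint : Integrable (fun q : X × X => K q.1 q.2 * z q.1 q.2 *
      (nonlocalGrad w q.1 q.2 - nonlocalGrad u q.1 q.2)) (ν ⊗ₘ m) := by
    refine (hw'.add hu').mono' (((hK.measurable.mul hzm).mul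
      ((measurable_nonlocalGrad hwm).sub (measurable_nonlocalGrad hum))).aestronglyMeasurable)
      (Eventually.of_forall fun q => ?_)
    simp only [Pi.add_apply, energyDensity, Real.rpow_one, Real.norm_eq_abs, abs_mul,
      abs_of_nonneg (hK.nonneg q.1 q.2)]
    rw [mul_assoc, ← mul_add]
    refine mul_le_mul_of_nonneg_left ?_ (hK.nonneg _ _)
    refine (mul_le_of_le_one_left (abs_nonneg _) (hz _ _)).trans (abs_sub _ _)
  rw [inner_sub_eq_of_flux hrev (G := fun x y => K x y * z x y) (hK.measurable.mul hzm)
    (fun x y => by rw [hK.symm y x, hanti]; ring) (D := 0) (integrable_zero _ _ _)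
    (fun q => ?_) hv hint]
  · have : ∫ q, K q.1 q.2 * z q.1 q.2 * (nonlocalGrad w q.1 q.2 - nonlocalGrad u q.1 q.2) ∂(ν ⊗ₘ m)
        ≤ ∫ q, (energyDensity K 1 w q - energyDensity K 1 u q) ∂(ν ⊗ₘ m) := by
      refine integral_mono hint (hw'.sub hu') fun q => ?_
      simp only [energyDensity, Real.rpow_one]
      have h1 : z q.1 q.2 * nonlocalGrad w q.1 q.2 ≤ |nonlocalGrad w q.1 q.2| := by
        refine (le_abs_self _).trans ?_
        rw [abs_mul]
        exact mul_le_of_le_one_left (abs_nonneg _) (hz _ _)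
      have h2 := hzu q.1 q.2
      have := mul_le_mul_of_nonneg_left h1 (hK.nonneg q.1 q.2)
      rw [← h2]
      linarith
    rw [integral_sub hw' hu'] at this
    linarith
  · rw [abs_mul, abs_of_nonneg (hK.nonneg _ _), Pi.zero_apply, add_zero]
    exact mul_le_one₀ (hK.le_one _ _) (abs_nonneg _) (hz _ _)

theorem abs_mul_signedPow_le {K : X → X → ℝ} (hK : IsSymmWeight K) {p : ℝ} (hp : 1 < p)
    (f : X → ℝ) (q : X × X) :
    |K q.1 q.2 * signedPow p (nonlocalGrad f q.1 q.2)| ≤ 1 + energyDensity K p f q := by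
  rw [abs_mul, abs_of_nonneg (hK.nonneg _ _), abs_signedPow hp, energyDensity]
  have h1 := mul_le_mul_of_nonneg_left
    (rpow_sub_one_le hp (abs_nonneg (nonlocalGrad f q.1 q.2))) (hK.nonneg q.1 q.2)
  linarith [hK.le_one q.1 q.2]

omit [MeasurableSpace X] in
theorem nonlocalGrad_antisymm (f : X → ℝ) (x y : X) : nonlocalGrad f y x = -nonlocalGrad f x y := by
  simp [nonlocalGrad]

theorem mul_signedPow_antisymm {K : X → X → ℝ} (hK : IsSymmWeight K) (p : ℝ) (f : X → ℝ)
    (x y : X) : K y x * signedPow p (nonlocalGrad f y x)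
      = -(K x y * signedPow p (nonlocalGrad f x y)) := by
  rw [nonlocalGrad_antisymm, signedPow_neg, hK.symm y x]; ring

theorem measurable_mul_signedPow {K : X → X → ℝ} (hK : IsSymmWeight K) (p : ℝ) {f : X → ℝ}
    (hf : Measurable f) :
    Measurable (fun q : X × X => K q.1 q.2 * signedPow p (nonlocalGrad f q.1 q.2)) :=
  hK.measurable.mul ((measurable_signedPow p).comp (measurable_nonlocalGrad hf))

/-- If the divergence of `K |∇u| ^ (p - 2) ∇u` is in `L²`, it gives the subgradient of the
`p`-energy. -/
theorem mem_subdifferential_of_signedPow_flux (hrev : m.IsReversible ν) {K : X → X → ℝ}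
    (hK : IsSymmWeight K) {p : ℝ} (hp : 1 < p) {u v : Lp ℝ 2 ν}
    (hu : weightedEnergy m ν K p u ≠ ∞)
    (hv : ∀ᵐ x ∂ν, v x = -∫ y, K x y * signedPow p (nonlocalGrad u x y) ∂(m x)) :
    v ∈ subdifferential (fun w : Lp ℝ 2 ν => (weightedEnergy m ν K p w : EReal)) u := by
  rw [mem_subdifferential_coe_iff]
  refine ⟨hu, fun w hw => ?_⟩
  have hp0 : 0 < p := by linarith
  have hum := measurable_Lp u
  have hwm := measurable_Lp w
  rw [toReal_weightedEnergy hK hp0 hum, toReal_weightedEnergy hK hp0 hwm]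
  have hu' := (weightedEnergy_ne_top_iff hK hp0 hum).1 hu
  have hw' := (weightedEnergy_ne_top_iff hK hp0 hwm).1 hw
  have hGm := measurable_mul_signedPow hK p hum
  have hint : Integrable (fun q : X × X => K q.1 q.2 * signedPow p (nonlocalGrad u q.1 q.2) *
      (nonlocalGrad w q.1 q.2 - nonlocalGrad u q.1 q.2)) (ν ⊗ₘ m) := by
    refine (hw'.add (hu'.const_mul 2)).mono' ((hGm.mul
      ((measurable_nonlocalGrad hwm).sub (measurable_nonlocalGrad hum))).aestronglyMeasurable)
      (Eventually.of_forall fun q => ?_)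
    simp only [Pi.add_apply, energyDensity, Real.norm_eq_abs, abs_mul,
      abs_of_nonneg (hK.nonneg q.1 q.2), abs_signedPow hp]
    set a := nonlocalGrad u q.1 q.2
    set b := nonlocalGrad w q.1 q.2
    have h1 := rpow_sub_one_mul_le hp (abs_nonneg a) (abs_nonneg b)
    have h2 := rpow_sub_one_mul_le hp (abs_nonneg a) (abs_nonneg a)
    have h3 : |a| ^ (p - 1) * |a| = |a| ^ p := by
      rcases eq_or_ne a 0 with h | h
      · simp [h, Real.zero_rpow hp0.ne']
      · rw [← Real.rpow_add_one (abs_pos.2 h).ne', sub_add_cancel]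
    have h4 := mul_le_mul_of_nonneg_left (abs_sub b a) (Real.rpow_nonneg (abs_nonneg a) (p - 1))
    have h5 : |a| ^ (p - 1) * |b - a| ≤ |b| ^ p + 2 * |a| ^ p := by linarith
    have := mul_le_mul_of_nonneg_left h5 (hK.nonneg q.1 q.2)
    linarith
  rw [inner_sub_eq_of_flux hrev hGm (mul_signedPow_antisymm hK p u) hu'
    (abs_mul_signedPow_le hK hp u) hv hint]
  have : ∫ q, p * (K q.1 q.2 * signedPow p (nonlocalGrad u q.1 q.2) *
        (nonlocalGrad w q.1 q.2 - nonlocalGrad u q.1 q.2)) ∂(ν ⊗ₘ m)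
      ≤ ∫ q, (energyDensity K p w q - energyDensity K p u q) ∂(ν ⊗ₘ m) := by
    refine integral_mono (hint.const_mul p) (hw'.sub hu') fun q => ?_
    simp only [energyDensity]
    have := mul_le_mul_of_nonneg_left
      (abs_rpow_tangent hp (nonlocalGrad u q.1 q.2) (nonlocalGrad w q.1 q.2)) (hK.nonneg q.1 q.2)
    linarith
  rw [integral_sub hw' hu', integral_const_mul] at this
  have h6 := mul_le_mul_of_nonneg_left this (show (0 : ℝ) ≤ 1 / (2 * p) by positivity)
  rw [← mul_assoc, show 1 / (2 * p) * p = 1 / 2 by field_simp] at h6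
  linarith

end Flux

/-! ### Duality: functionals dominated by an `L¹` norm -/

section Duality

variable {Y : Type*} [MeasurableSpace Y] {μ : Measure Y} [IsFiniteMeasure μ]

theorem integrable_Lp (h : Lp ℝ 2 μ) : Integrable h μ :=
  (Lp.memLp h).integrable (by norm_num)

theorem integral_abs_le_norm (h : Lp ℝ 2 μ) :
    ∫ y, |h y| ∂μ ≤ ‖h‖ * ‖Lp.const 2 μ (1 : ℝ)‖ := by
  have h1 : inner ℝ |h| (Lp.const 2 μ (1 : ℝ)) = ∫ y, |h y| ∂μ := by
    rw [inner_Lp_eq]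
    refine integral_congr_ae ?_
    filter_upwards [Lp.coeFn_abs h, Lp.coeFn_const 2 μ (1 : ℝ)] with y hy1 hy2
    rw [hy1, hy2]; simp
  rw [← h1, ← norm_abs_eq_norm h]
  exact real_inner_le_norm _ _

/-- A linear functional on `L²` of a finite measure that is bounded by the `L¹` norm is integration
against a function with values in `[-1, 1]`. -/
theorem exists_density_of_le_integral_abs (Λ : Lp ℝ 2 μ →ₗ[ℝ] ℝ)
    (hΛ : ∀ h, Λ h ≤ ∫ y, |h y| ∂μ) :
    ∃ k : Y → ℝ, Measurable k ∧ (∀ y, |k y| ≤ 1) ∧ ∀ h : Lp ℝ 2 μ, Λ h = ∫ y, k y * h y ∂μ := by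
  have habs : ∀ h, |Λ h| ≤ ∫ y, |h y| ∂μ := fun h => by
    refine abs_le'.2 ⟨hΛ h, ?_⟩
    rw [← map_neg]
    refine (hΛ (-h)).trans_eq (integral_congr_ae ?_)
    filter_upwards [Lp.coeFn_neg h] with y hy
    rw [hy, Pi.neg_apply, abs_neg]
  set Λc : Lp ℝ 2 μ →L[ℝ] ℝ := Λ.mkContinuous ‖Lp.const 2 μ (1 : ℝ)‖ fun h => by
    rw [mul_comm]
    exact (habs h).trans (integral_abs_le_norm h) with hΛc
  set k₀ : Lp ℝ 2 μ := (InnerProductSpace.toDual ℝ _).symm Λc with hk₀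
  have hk : ∀ h, Λ h = ∫ y, k₀ y * h y ∂μ := fun h => by
    rw [← inner_Lp_eq, hk₀, InnerProductSpace.toDual_symm_apply]
    rfl
  have hset : ∀ s, MeasurableSet s → μ s < ∞ →
      |∫ y in s, k₀ y ∂μ| ≤ ∫ _ in s, (1 : ℝ) ∂μ := by
    intro s hs hfin
    have h1 := habs (indicatorConstLp 2 hs hfin.ne 1)
    have h2 : Λ (indicatorConstLp 2 hs hfin.ne 1) = ∫ y in s, k₀ y ∂μ := by
      rw [hk, ← inner_Lp_eq, real_inner_comm, L2.inner_indicatorConstLp_one]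
    rw [h2] at h1
    refine h1.trans_eq ?_
    rw [← integral_indicator hs]
    refine integral_congr_ae ?_
    filter_upwards [indicatorConstLp_coeFn (p := 2) (hs := hs) (hμs := hfin.ne) (c := (1 : ℝ))]
      with y hy
    rw [hy]
    by_cases hys : y ∈ s <;> simp [hys]
  have hle : k₀ ≤ᵐ[μ] fun _ => (1 : ℝ) :=
    ae_le_of_forall_setIntegral_le (integrable_Lp k₀) (integrable_const _) fun s hs hfin =>
      (le_abs_self _).trans (hset s hs hfin)
  have hge : (fun _ => (-1 : ℝ)) ≤ᵐ[μ] k₀ :=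
    ae_le_of_forall_setIntegral_le (integrable_const _) (integrable_Lp k₀) fun s hs hfin => by
      rw [integral_const] at *
      have h1 := hset s hs hfin
      rw [integral_const] at h1
      have h2 := (abs_le.1 h1).1
      simp only [smul_eq_mul, mul_neg, mul_one] at h2 ⊢
      exact h2
  refine ⟨fun y => max (-1) (min 1 (k₀ y)),
    measurable_const.max (measurable_const.min (measurable_Lp k₀)), fun y => ?_, fun h => ?_⟩
  · rw [abs_le]
    exact ⟨le_max_left _ _, max_le (by norm_num) (min_le_left _ _)⟩
  · rw [hk]
    refine integral_congr_ae ?_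
    filter_upwards [hle, hge] with y h1 h2
    rw [min_eq_right h1, max_eq_right h2]

/-- Hahn–Banach and Riesz: a linear functional `L` with `L φ ≤ ∫ |T φ| dμ` is `φ ↦ ∫ k T φ dμ` for
some `k` with values in `[-1, 1]`. -/
theorem exists_density_of_le_integral_abs_comp {D : Type*} [AddCommGroup D] [Module ℝ D]
    (T : D →ₗ[ℝ] Y → ℝ) (hT : ∀ φ, MemLp (T φ) 2 μ) (L : D →ₗ[ℝ] ℝ)
    (hL : ∀ φ, L φ ≤ ∫ y, |T φ y| ∂μ) :
    ∃ k : Y → ℝ, Measurable k ∧ (∀ y, |k y| ≤ 1) ∧ ∀ φ, L φ = ∫ y, k y * T φ y ∂μ := by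
  -- Extend `(φ, 0) ↦ L φ` to `D × L²` below the seminorm `(φ, h) ↦ ∫ |T φ + h| dμ`; this seminorm
  -- vanishes at `(φ, -T φ)`, so that the extension sees `φ` only through `T φ`.
  set N : D × Lp ℝ 2 μ → ℝ := fun x => ∫ y, |T x.1 y + x.2 y| ∂μ with hN
  have hint : ∀ x : D × Lp ℝ 2 μ, Integrable (fun y => |T x.1 y + x.2 y|) μ := fun x =>
    (((hT x.1).integrable (by norm_num)).add (integrable_Lp x.2)).abs
  obtain ⟨g, hg1, hg2⟩ := exists_extension_of_le_sublinear
    (⟨Submodule.prod ⊤ ⊥, L ∘ₗ LinearMap.fst ℝ D (Lp ℝ 2 μ) ∘ₗ Submodule.subtype _⟩ :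
      D × Lp ℝ 2 μ →ₗ.[ℝ] ℝ) N
    (fun c hc x => by
      simp only [hN]
      rw [← integral_const_mul]
      refine integral_congr_ae ?_
      filter_upwards [Lp.coeFn_smul c x.2] with y hy
      rw [Prod.smul_snd, hy, Prod.smul_fst, map_smul, Pi.smul_apply, Pi.smul_apply, smul_eq_mul,
        smul_eq_mul, ← mul_add, abs_mul, abs_of_pos hc])
    (fun x x' => by
      simp only [hN]
      rw [← integral_add (hint x) (hint x')]
      refine integral_mono_ae (hint _) ((hint x).add (hint x')) ?_
      filter_upwards [Lp.coeFn_add x.2 x'.2] with y hy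
      rw [Prod.snd_add, hy, Prod.fst_add, map_add, Pi.add_apply, Pi.add_apply,
        add_add_add_comm]
      exact abs_add_le _ _)
    (fun x => by
      obtain ⟨⟨φ, h⟩, -, hx⟩ := x
      have h0 : h = 0 := hx
      subst h0
      refine (hL φ).trans_eq ?_
      simp only [hN]
      refine integral_congr_ae ?_
      filter_upwards [Lp.coeFn_zero ℝ 2 μ] with y hy
      rw [hy, Pi.zero_apply, add_zero])
  have hgL : ∀ φ, g (φ, 0) = L φ := fun φ => hg1 ⟨(φ, 0), by simp⟩
  obtain ⟨k, hkm, hk1, hk⟩ := exists_density_of_le_integral_abs (g ∘ₗ LinearMap.inr ℝ D (Lp ℝ 2 μ))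
    (fun h => by
      refine (hg2 _).trans_eq ?_
      simp [hN])
  refine ⟨k, hkm, hk1, fun φ => ?_⟩
  have hle : ∀ φ, g (φ, -(hT φ).toLp) ≤ 0 := fun φ => by
    refine (hg2 _).trans_eq ?_
    simp only [hN]
    rw [← integral_zero Y ℝ (μ := μ)]
    refine integral_congr_ae ?_
    filter_upwards [Lp.coeFn_neg (hT φ).toLp, (hT φ).coeFn_toLp] with y h1 h2
    rw [h1, Pi.neg_apply, h2, add_neg_cancel, abs_zero]
  have hsplit : ∀ φ, g (φ, -(hT φ).toLp) = L φ - g (0, (hT φ).toLp) := fun φ => by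
    rw [← hgL, ← map_sub]
    simp
  have h1 := hle φ
  have h2 := hle (-φ)
  rw [hsplit] at h1 h2
  have h3 : g (0, (hT (-φ)).toLp) = -g (0, (hT φ).toLp) := by
    rw [← map_neg, Prod.neg_mk, neg_zero]
    congr 2
    rw [← MemLp.toLp_neg]
    exact MemLp.toLp_congr _ _ (Eventually.of_forall fun y => by rw [map_neg])
  rw [h3, map_neg] at h2
  have h4 : L φ = g (0, (hT φ).toLp) := by linarith
  rw [h4]
  refine (hk ((hT φ).toLp _)).trans (integral_congr_ae ?_)
  filter_upwards [(hT φ).coeFn_toLp] with y hy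
  exact congrArg (k y * ·) hy

end Duality

/-! ### Directional derivatives of the energies -/

theorem tendsto_one_div_add_one_nhdsNE :
    Tendsto (fun n : ℕ => 1 / ((n : ℝ) + 1)) atTop (𝓝[≠] 0) :=
  tendsto_nhdsWithin_iff.2 ⟨tendsto_one_div_add_atTop_nhds_zero_nat,
    Eventually.of_forall fun n => (show 1 / ((n : ℝ) + 1) ≠ 0 by positivity)⟩

theorem tendsto_quotient_of_hasDerivAt {f : ℝ → ℝ} {a b f' : ℝ} (hf : HasDerivAt f f' a) :
    Tendsto (fun n : ℕ => (f (a + 1 / ((n : ℝ) + 1) * b) - f a) / (1 / ((n : ℝ) + 1))) atTop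
      (𝓝 (f' * b)) := by
  have h1 : HasDerivAt (fun t : ℝ => f (a + t * b)) (f' * b) 0 := by
    have h2 : HasDerivAt (fun t : ℝ => a + t * b) b 0 := by
      simpa using ((hasDerivAt_id (0 : ℝ)).mul_const b).const_add a
    exact HasDerivAt.comp (0 : ℝ) (by simpa using hf) h2
  have h3 := h1.tendsto_slope_zero.comp tendsto_one_div_add_one_nhdsNE
  refine h3.congr fun n => ?_
  simp only [Function.comp, zero_add, zero_mul, add_zero, smul_eq_mul]
  exact (div_eq_inv_mul _ _).symm

theorem hasDerivAt_abs_div {a : ℝ} (ha : a ≠ 0) : HasDerivAt (fun t : ℝ => |t|) (a / |a|) a := by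
  convert hasDerivAt_abs ha using 1
  rcases lt_or_gt_of_ne ha with h | h
  · simp [h, abs_of_neg h, ha]
  · simp [h, abs_of_pos h, ha]

open Classical in
theorem tendsto_abs_quotient (a b : ℝ) :
    Tendsto (fun n : ℕ => (|a + 1 / ((n : ℝ) + 1) * b| - |a|) / (1 / ((n : ℝ) + 1))) atTop
      (𝓝 (a / |a| * b + if a = 0 then |b| else 0)) := by
  by_cases ha : a = 0
  · subst ha
    refine tendsto_const_nhds.congr fun n => ?_
    have : (0 : ℝ) < 1 / ((n : ℝ) + 1) := by positivity
    rw [zero_add, abs_mul, abs_of_pos this, abs_zero, sub_zero, mul_div_cancel_left₀ _ this.ne']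
    simp
  · simpa [ha] using tendsto_quotient_of_hasDerivAt (b := b) (hasDerivAt_abs_div ha)

omit [MeasurableSpace X] in
theorem nonlocalGrad_add_smul (f g : X → ℝ) (t : ℝ) (x y : X) :
    nonlocalGrad (f + t • g) x y = nonlocalGrad f x y + t * nonlocalGrad g x y := by
  simp only [nonlocalGrad, Pi.add_apply, Pi.smul_apply, smul_eq_mul]; ring

theorem integrable_energyDensity_add_smul {K : X → X → ℝ} (hK : IsSymmWeight K) {p : ℝ}
    (hp : 1 ≤ p) {f g : X → ℝ} (hf : Measurable f) (hg : Measurable g)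
    (hf' : Integrable (energyDensity K p f) (ν ⊗ₘ m))
    (hg' : Integrable (energyDensity K p g) (ν ⊗ₘ m)) (t : ℝ) :
    Integrable (energyDensity K p (f + t • g)) (ν ⊗ₘ m) := by
  refine ((hf'.add (hg'.const_mul (|t| ^ p))).const_mul (2 ^ p)).mono'
    (hK.measurable_energyDensity p (hf.add (hg.const_smul t))).aestronglyMeasurable
    (Eventually.of_forall fun q => ?_)
  rw [Real.norm_of_nonneg (hK.energyDensity_nonneg _ _ _)]
  simp only [energyDensity, Pi.add_apply, nonlocalGrad_add_smul]
  have h := mul_le_mul_of_nonneg_left (abs_rpow_add_le hp (nonlocalGrad f q.1 q.2)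
    (t * nonlocalGrad g q.1 q.2)) (hK.nonneg q.1 q.2)
  rw [abs_mul t, Real.mul_rpow (abs_nonneg _) (abs_nonneg _)] at h
  linarith

theorem integrable_signedPow_mul {K : X → X → ℝ} (hK : IsSymmWeight K) {p : ℝ}
    (hp : 1 < p) {f g : X → ℝ} (hf : Measurable f) (hg : Measurable g)
    (hf' : Integrable (energyDensity K p f) (ν ⊗ₘ m))
    (hg' : Integrable (energyDensity K p g) (ν ⊗ₘ m)) :
    Integrable (fun q : X × X => K q.1 q.2 * signedPow p (nonlocalGrad f q.1 q.2) *
      nonlocalGrad g q.1 q.2) (ν ⊗ₘ m) := by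
  refine (hf'.add hg').mono' ((measurable_mul_signedPow hK p hf).mul
    (measurable_nonlocalGrad hg)).aestronglyMeasurable (Eventually.of_forall fun q => ?_)
  simp only [Pi.add_apply, energyDensity, Real.norm_eq_abs, abs_mul,
    abs_of_nonneg (hK.nonneg q.1 q.2), abs_signedPow hp]
  rw [mul_assoc, ← mul_add]
  exact mul_le_mul_of_nonneg_left (rpow_sub_one_mul_le hp (abs_nonneg _) (abs_nonneg _))
    (hK.nonneg _ _)

theorem measurable_sign_nonlocalGrad {u : X → ℝ} (hu : Measurable u) :
    Measurable (fun q : X × X => nonlocalGrad u q.1 q.2 / |nonlocalGrad u q.1 q.2|) :=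
  (measurable_nonlocalGrad hu).div (measurable_nonlocalGrad hu).abs

theorem abs_div_abs_le_one (a : ℝ) : |a / abs a| ≤ 1 := by
  rw [abs_div, abs_abs]; exact div_self_le_one _

open Classical in
/-- A subgradient inequality along the ray `u + t φ` yields, in the limit `t → 0⁺`, an inequality
for the directional derivatives. The term with `|∇φ|` comes from the pairs where `∇u = 0`. -/
theorem two_mul_le_directional [IsMarkovKernel m] [SigmaFinite ν] (hrev : m.IsReversible ν)
    {K₁ K₂ : X → X → ℝ} (hK₁ : IsSymmWeight K₁) (hK₂ : IsSymmWeight K₂) {p : ℝ} (hp : 1 < p)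
    {u φ : X → ℝ} (hu : Measurable u) (hφ : Measurable φ)
    (hu₁ : Integrable (energyDensity K₁ 1 u) (ν ⊗ₘ m))
    (hu₂ : Integrable (energyDensity K₂ p u) (ν ⊗ₘ m)) (hφint : Integrable φ ν)
    (hφ₂ : Integrable (energyDensity K₂ p φ) (ν ⊗ₘ m)) {c : ℝ}
    (hsub : ∀ t : ℝ, 0 < t →
      1 / 2 * ∫ q, energyDensity K₁ 1 u q ∂(ν ⊗ₘ m)
          + 1 / (2 * p) * ∫ q, energyDensity K₂ p u q ∂(ν ⊗ₘ m) + t * c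
        ≤ 1 / 2 * ∫ q, energyDensity K₁ 1 (u + t • φ) q ∂(ν ⊗ₘ m)
          + 1 / (2 * p) * ∫ q, energyDensity K₂ p (u + t • φ) q ∂(ν ⊗ₘ m)) :
    2 * c ≤ ∫ q, (K₁ q.1 q.2 * (nonlocalGrad u q.1 q.2 / |nonlocalGrad u q.1 q.2|)
            + K₂ q.1 q.2 * signedPow p (nonlocalGrad u q.1 q.2)) *
            nonlocalGrad φ q.1 q.2 ∂(ν ⊗ₘ m)
        + ∫ q, K₁ q.1 q.2 * (if nonlocalGrad u q.1 q.2 = 0 then |nonlocalGrad φ q.1 q.2| else 0)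
            ∂(ν ⊗ₘ m) := by
  have hp0 : 0 < p := by linarith
  have hgu := measurable_nonlocalGrad hu
  have hgφ := measurable_nonlocalGrad hφ
  have hgφint := integrable_nonlocalGrad hrev hφint
  set t : ℕ → ℝ := fun n => 1 / ((n : ℝ) + 1) with ht
  have ht0 : ∀ n, 0 < t n := fun n => by positivity
  have ht1 : ∀ n, t n ≤ 1 := fun n => by
    rw [ht]; simp only
    rw [div_le_one (by positivity)]
    linarith [(Nat.cast_nonneg n : (0 : ℝ) ≤ n)]
  have hφ₁ : Integrable (energyDensity K₁ 1 φ) (ν ⊗ₘ m) := by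
    refine hgφint.abs.mono' (hK₁.measurable_energyDensity 1 hφ).aestronglyMeasurable
      (Eventually.of_forall fun q => ?_)
    rw [Real.norm_of_nonneg (hK₁.energyDensity_nonneg _ _ _), energyDensity, Real.rpow_one]
    exact mul_le_of_le_one_left (abs_nonneg _) (hK₁.le_one _ _)
  set Q₁ : ℕ → X × X → ℝ := fun n q =>
    K₁ q.1 q.2 * ((|nonlocalGrad u q.1 q.2 + t n * nonlocalGrad φ q.1 q.2|
      - |nonlocalGrad u q.1 q.2|) / t n) with hQ₁
  set Q₂ : ℕ → X × X → ℝ := fun n q =>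
    1 / p * (K₂ q.1 q.2 * ((|nonlocalGrad u q.1 q.2 + t n * nonlocalGrad φ q.1 q.2| ^ p
      - |nonlocalGrad u q.1 q.2| ^ p) / t n)) with hQ₂
  have hQ₁eq : ∀ n q, Q₁ n q
      = (energyDensity K₁ 1 (u + t n • φ) q - energyDensity K₁ 1 u q) / t n := fun n q => by
    simp only [hQ₁, energyDensity, nonlocalGrad_add_smul, Real.rpow_one]; ring
  have hQ₂eq : ∀ n q, Q₂ n q
      = 1 / p * ((energyDensity K₂ p (u + t n • φ) q - energyDensity K₂ p u q) / t n) :=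
    fun n q => by simp only [hQ₂, energyDensity, nonlocalGrad_add_smul]; ring
  have hI₁ := fun n => integrable_energyDensity_add_smul hK₁ le_rfl hu hφ hu₁ hφ₁ (t n)
  have hI₂ := fun n => integrable_energyDensity_add_smul hK₂ hp.le hu hφ hu₂ hφ₂ (t n)
  have hI₂' := integrable_energyDensity_add_smul hK₂ hp.le hu hφ hu₂ hφ₂ 1
  have hQ₁int : ∀ n, Integrable (Q₁ n) (ν ⊗ₘ m) := fun n => by
    simp_rw [funext (hQ₁eq n)]; exact ((hI₁ n).sub hu₁).div_const _
  have hQ₂int : ∀ n, Integrable (Q₂ n) (ν ⊗ₘ m) := fun n => by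
    simp_rw [funext (hQ₂eq n)]; exact (((hI₂ n).sub hu₂).div_const _).const_mul _
  have hlim₁ : Tendsto (fun n => ∫ q, Q₁ n q ∂(ν ⊗ₘ m)) atTop (𝓝 (∫ q, K₁ q.1 q.2 *
      (nonlocalGrad u q.1 q.2 / |nonlocalGrad u q.1 q.2| * nonlocalGrad φ q.1 q.2 +
        if nonlocalGrad u q.1 q.2 = 0 then |nonlocalGrad φ q.1 q.2| else 0) ∂(ν ⊗ₘ m))) := by
    refine tendsto_integral_of_dominated_convergence _ (fun n => (hQ₁int n).1) hgφint.abs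
      (fun n => Eventually.of_forall fun q => ?_)
      (Eventually.of_forall fun q => (tendsto_abs_quotient _ _).const_mul _)
    simp only [hQ₁, Real.norm_eq_abs, abs_mul, abs_div, abs_of_nonneg (hK₁.nonneg q.1 q.2),
      abs_of_pos (ht0 n)]
    refine (mul_le_of_le_one_left (by positivity) (hK₁.le_one _ _)).trans ?_
    rw [div_le_iff₀ (ht0 n)]
    refine (abs_abs_sub_abs_le _ _).trans ?_
    rw [add_sub_cancel_left, abs_mul, abs_of_pos (ht0 n), mul_comm]
  have hlim₂ : Tendsto (fun n => ∫ q, Q₂ n q ∂(ν ⊗ₘ m)) atTop (𝓝 (∫ q, 1 / p * (K₂ q.1 q.2 *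
      (p * signedPow p (nonlocalGrad u q.1 q.2) * nonlocalGrad φ q.1 q.2)) ∂(ν ⊗ₘ m))) := by
    refine tendsto_integral_of_dominated_convergence
      (fun q => |K₂ q.1 q.2 * signedPow p (nonlocalGrad u q.1 q.2) * nonlocalGrad φ q.1 q.2|
        + 1 / p * energyDensity K₂ p (u + (1 : ℝ) • φ) q) (fun n => (hQ₂int n).1)
      ((integrable_signedPow_mul hK₂ hp hu hφ hu₂ hφ₂).abs.add (hI₂'.const_mul _))
      (fun n => Eventually.of_forall fun q => ?_)
      (Eventually.of_forall fun q =>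
        ((tendsto_quotient_of_hasDerivAt (hasDerivAt_abs_rpow' hp _)).const_mul _).const_mul _)
    -- The quotients of a convex function lie between its derivative and the quotient at `t = 1`.
    simp only [hQ₂, energyDensity, nonlocalGrad_add_smul]
    set a := nonlocalGrad u q.1 q.2
    set b := nonlocalGrad φ q.1 q.2
    have hlow := abs_rpow_tangent hp a (a + t n * b)
    have hup := (convexOn_abs_rpow hp.le).2 (Set.mem_univ a) (Set.mem_univ (a + b))
      (sub_nonneg.2 (ht1 n)) (ht0 n).le (by ring)
    simp only [smul_eq_mul] at hup
    rw [show (1 - t n) * a + t n * (a + b) = a + t n * b by ring] at hup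
    have hlow' : p * (signedPow p a * b) ≤ (|a + t n * b| ^ p - |a| ^ p) / t n := by
      rw [le_div_iff₀ (ht0 n)]; linarith
    have hup' : (|a + t n * b| ^ p - |a| ^ p) / t n ≤ |a + b| ^ p - |a| ^ p := by
      rw [div_le_iff₀ (ht0 n)]; linarith
    have hk := hK₂.nonneg q.1 q.2
    have ha := Real.rpow_nonneg (abs_nonneg a) p
    have hab := Real.rpow_nonneg (abs_nonneg (a + b)) p
    have hpi : 0 < 1 / p := by positivity
    have hpp : 1 / p * p = 1 := by field_simp
    rw [Real.norm_eq_abs, one_mul, abs_le]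
    constructor
    · have h1 := mul_le_mul_of_nonneg_left (mul_le_mul_of_nonneg_left hlow' hk) hpi.le
      have h2 : 1 / p * (K₂ q.1 q.2 * (p * (signedPow p a * b)))
          = K₂ q.1 q.2 * signedPow p a * b := by field_simp
      rw [h2] at h1
      have h3 := neg_abs_le (K₂ q.1 q.2 * signedPow p a * b)
      have h4 : 0 ≤ 1 / p * (K₂ q.1 q.2 * |a + b| ^ p) := by positivity
      linarith
    · have h1 := mul_le_mul_of_nonneg_left (mul_le_mul_of_nonneg_left hup' hk) hpi.le
      have h3 := abs_nonneg (K₂ q.1 q.2 * signedPow p a * b)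
      have h4 : 0 ≤ 1 / p * (K₂ q.1 q.2 * |a| ^ p) := by positivity
      linarith
  have hineq : ∀ n, 2 * c ≤ ∫ q, Q₁ n q ∂(ν ⊗ₘ m) + ∫ q, Q₂ n q ∂(ν ⊗ₘ m) := fun n => by
    simp_rw [funext (hQ₁eq n), funext (hQ₂eq n)]
    rw [integral_div, integral_const_mul, integral_div, integral_sub (hI₁ n) hu₁,
      integral_sub (hI₂ n) hu₂]
    have h := hsub (t n) (ht0 n)
    rw [← mul_le_mul_iff_of_pos_left (ht0 n)]
    rw [mul_add, mul_div_cancel₀ _ (ht0 n).ne', mul_left_comm _ (1 / p),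
      mul_div_cancel₀ _ (ht0 n).ne']
    have h5 : 1 / (2 * p) = 1 / 2 * (1 / p) := by field_simp
    rw [h5] at h
    linarith
  have hfin := le_of_tendsto_of_tendsto' tendsto_const_nhds (hlim₁.add hlim₂) hineq
  refine hfin.trans_eq ?_
  have hs : Integrable (fun q : X × X => K₁ q.1 q.2 * (nonlocalGrad u q.1 q.2 /
      |nonlocalGrad u q.1 q.2| * nonlocalGrad φ q.1 q.2)) (ν ⊗ₘ m) := by
    refine hgφint.abs.mono' (hK₁.measurable.mul ((measurable_sign_nonlocalGrad hu).mul
      hgφ)).aestronglyMeasurable (Eventually.of_forall fun q => ?_)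
    rw [Real.norm_eq_abs, abs_mul, abs_of_nonneg (hK₁.nonneg _ _), abs_mul]
    exact (mul_le_of_le_one_left (by positivity) (hK₁.le_one _ _)).trans
      (mul_le_of_le_one_left (abs_nonneg _) (abs_div_abs_le_one _))
  have hz : Integrable (fun q : X × X => K₁ q.1 q.2 *
      (if nonlocalGrad u q.1 q.2 = 0 then |nonlocalGrad φ q.1 q.2| else 0)) (ν ⊗ₘ m) := by
    refine hgφint.abs.mono' (hK₁.measurable.mul (Measurable.ite
      (hgu (measurableSet_singleton 0)) hgφ.abs measurable_const)).aestronglyMeasurable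
      (Eventually.of_forall fun q => ?_)
    rw [Real.norm_eq_abs, abs_mul, abs_of_nonneg (hK₁.nonneg _ _)]
    refine (mul_le_of_le_one_left (abs_nonneg _) (hK₁.le_one _ _)).trans ?_
    split_ifs <;> simp
  have hP := integrable_signedPow_mul hK₂ hp hu hφ hu₂ hφ₂
  simp_rw [mul_add, add_mul]
  rw [integral_add hs hz]
  have h6 : ∀ q : X × X, 1 / p * (K₂ q.1 q.2 * (p * signedPow p (nonlocalGrad u q.1 q.2) *
      nonlocalGrad φ q.1 q.2)) = K₂ q.1 q.2 * signedPow p (nonlocalGrad u q.1 q.2) *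
      nonlocalGrad φ q.1 q.2 := fun q => by field_simp
  simp_rw [h6]
  rw [integral_add (by simpa only [mul_assoc] using hs) hP]
  simp_rw [mul_assoc]
  ring

/-! ### Subgradients give fluxes -/

/-- An integrable function with values in `(0, 1]`. -/
structure IsTestWeight (ν : Measure X) (a : X → ℝ) : Prop where
  measurable : Measurable a
  pos : ∀ x, 0 < a x
  le_one : ∀ x, a x ≤ 1
  integrable : Integrable a ν

theorem exists_isTestWeight (ν : Measure X) [SigmaFinite ν] : ∃ a, IsTestWeight ν a := by
  obtain ⟨g, hg0, hgm, hg⟩ := exists_pos_lintegral_lt_of_sigmaFinite ν one_ne_zero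
  have hgi : Integrable (fun x => (g x : ℝ)) ν := by
    refine ⟨hgm.coe_nnreal_real.aestronglyMeasurable, ?_⟩
    rw [hasFiniteIntegral_iff_ofReal (Eventually.of_forall fun x => (g x).coe_nonneg)]
    simpa using hg.trans ENNReal.one_lt_top
  refine ⟨fun x => min 1 (g x : ℝ), measurable_const.min hgm.coe_nnreal_real,
    fun x => lt_min one_pos (hg0 x), fun x => min_le_left _ _, ?_⟩
  refine hgi.mono' (measurable_const.min hgm.coe_nnreal_real).aestronglyMeasurable
    (Eventually.of_forall fun x => ?_)
  rw [Real.norm_of_nonneg (le_min zero_le_one (g x).coe_nonneg)]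
  exact min_le_right _ _

/-- The measurable functions dominated by a multiple of `a`. -/
def testSpace (a : X → ℝ) : Submodule ℝ (X → ℝ) where
  carrier := {φ | Measurable φ ∧ ∃ C, ∀ x, |φ x| ≤ C * a x}
  add_mem' := by
    rintro φ ψ ⟨hφ, C, hC⟩ ⟨hψ, C', hC'⟩
    refine ⟨hφ.add hψ, C + C', fun x => (abs_add_le _ _).trans ?_⟩
    linarith [hC x, hC' x]
  zero_mem' := ⟨measurable_const, 0, fun x => by simp⟩
  smul_mem' := by
    rintro c φ ⟨hφ, C, hC⟩
    refine ⟨hφ.const_smul c, |c| * C, fun x => ?_⟩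
    rw [Pi.smul_apply, smul_eq_mul, abs_mul, mul_assoc]
    exact mul_le_mul_of_nonneg_left (hC x) (abs_nonneg c)

section TestSpace

variable {a : X → ℝ} (ha : IsTestWeight ν a) {φ : X → ℝ} (hφ : φ ∈ testSpace a)
include ha hφ

theorem IsTestWeight.exists_bound : ∃ C, 0 ≤ C ∧ ∀ x, |φ x| ≤ C * a x ∧ |φ x| ≤ C := by
  obtain ⟨-, C, hC⟩ := hφ
  have h : ∀ x, |φ x| ≤ |C| * a x := fun x =>
    (hC x).trans (mul_le_mul_of_nonneg_right (le_abs_self C) (ha.pos x).le)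
  exact ⟨|C|, abs_nonneg C, fun x =>
    ⟨h x, (h x).trans (mul_le_of_le_one_right (abs_nonneg C) (ha.le_one x))⟩⟩

theorem IsTestWeight.integrable_of_mem : Integrable φ ν := by
  obtain ⟨C, -, hC⟩ := ha.exists_bound hφ
  exact (ha.integrable.const_mul C).mono' hφ.1.aestronglyMeasurable
    (Eventually.of_forall fun x => (hC x).1)

end TestSpace

theorem memLp_two_of_integrable_of_bound {f : X → ℝ} (hf : Integrable f ν) {C : ℝ}
    (hC : ∀ᵐ x ∂ν, |f x| ≤ C) : MemLp f 2 ν := by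
  rw [memLp_two_iff_integrable_sq hf.1]
  refine (hf.abs.const_mul C).mono' (hf.1.pow 2) ?_
  filter_upwards [hC] with x hx
  rw [Real.norm_eq_abs, abs_pow, pow_two]
  exact mul_le_mul_of_nonneg_right hx (abs_nonneg _)

omit [MeasurableSpace X] in
theorem abs_nonlocalGrad_le {f : X → ℝ} {C : ℝ} (hC : ∀ x, |f x| ≤ C) (x y : X) :
    |nonlocalGrad f x y| ≤ 2 * C :=
  (abs_sub _ _).trans (by linarith [hC x, hC y])

theorem integrable_energyDensity_of_bound [IsMarkovKernel m] [SigmaFinite ν]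
    (hrev : m.IsReversible ν) {K : X → X → ℝ} (hK : IsSymmWeight K) {p : ℝ} (hp : 1 ≤ p)
    {f : X → ℝ} (hfm : Measurable f) (hf : Integrable f ν) {C : ℝ} (hC : ∀ x, |f x| ≤ C) :
    Integrable (energyDensity K p f) (ν ⊗ₘ m) := by
  refine ((integrable_nonlocalGrad hrev hf).abs.const_mul ((2 * C) ^ (p - 1))).mono'
    (hK.measurable_energyDensity p hfm).aestronglyMeasurable (Eventually.of_forall fun q => ?_)
  rw [Real.norm_of_nonneg (hK.energyDensity_nonneg _ _ _)]
  exact (mul_le_of_le_one_left (Real.rpow_nonneg (abs_nonneg _) _) (hK.le_one _ _)).trans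
    (rpow_le_mul_of_le hp (abs_nonneg _) (abs_nonlocalGrad_le hC _ _))

theorem integrable_mul_of_bound [IsMarkovKernel m] [SigmaFinite ν] {G D : X × X → ℝ}
    (hG : Measurable G) (hD : Integrable D (ν ⊗ₘ m)) {c : ℝ} (hGD : ∀ q, |G q| ≤ c + D q)
    {f : X → ℝ} (hfm : Measurable f) (hf : Integrable f ν) {C : ℝ} (hC : ∀ x, |f x| ≤ C)
    (hD0 : ∀ q, 0 ≤ D q) : Integrable (fun q : X × X => f q.1 * G q) (ν ⊗ₘ m) := by
  refine (((integrable_fst hf).abs.const_mul c).add (hD.const_mul C)).mono'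
    ((hfm.comp measurable_fst).mul hG).aestronglyMeasurable (Eventually.of_forall fun q => ?_)
  rw [Real.norm_eq_abs, abs_mul, Pi.add_apply]
  have h1 := mul_le_mul_of_nonneg_left (hGD q) (abs_nonneg (f q.1))
  have h2 := mul_le_mul_of_nonneg_right (hC q.1) (hD0 q)
  linarith

/-- The nonlocal gradient divided by `a(x) + a(y)`, as a linear map on test functions. -/
noncomputable def weightedGrad (a : X → ℝ) : testSpace a →ₗ[ℝ] (X × X → ℝ) where
  toFun φ q := nonlocalGrad φ.1 q.1 q.2 / (a q.1 + a q.2)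
  map_add' φ ψ := by
    ext q
    simp only [nonlocalGrad, Submodule.coe_add, Pi.add_apply]; ring
  map_smul' c φ := by
    ext q
    simp only [nonlocalGrad, Submodule.coe_smul, Pi.smul_apply, smul_eq_mul, RingHom.id_apply]
    ring

theorem abs_weightedGrad_le {a : X → ℝ} (ha : IsTestWeight ν a) (φ : testSpace a) :
    ∃ C, ∀ q, |weightedGrad a φ q| ≤ C := by
  obtain ⟨C, hC0, hC⟩ := ha.exists_bound φ.2
  refine ⟨C, fun q => ?_⟩
  have hpos : 0 < a q.1 + a q.2 := add_pos (ha.pos _) (ha.pos _)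
  simp only [weightedGrad, LinearMap.coe_mk, AddHom.coe_mk, nonlocalGrad]
  rw [abs_div, abs_of_pos hpos, div_le_iff₀ hpos]
  exact (abs_sub _ _).trans (by linarith [(hC q.1).1, (hC q.2).1])

theorem measurable_weightedGrad {a : X → ℝ} (ha : IsTestWeight ν a) (φ : testSpace a) :
    Measurable (weightedGrad a φ) :=
  (measurable_nonlocalGrad φ.2.1).div
    ((ha.measurable.comp measurable_fst).add (ha.measurable.comp measurable_snd))

open Classical in
/-- A linear functional on test functions dominated by `∫_{∇u = 0} K |∇φ|` is
`φ ↦ ∫_{∇u = 0} K k ∇φ` with `|k| ≤ 1`. Here `∇u` enters only through its zero set `Z`. The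
gradients `∇φ` are bounded multiples of `g(x, y) = a(x) + a(y)`, and `g d(ν ⊗ m)` is a finite
measure. -/
theorem exists_density_nonlocalGrad [IsMarkovKernel m] [SigmaFinite ν] (hrev : m.IsReversible ν)
    {K : X → X → ℝ} (hK : IsSymmWeight K) {a : X → ℝ} (ha : IsTestWeight ν a)
    {Z : Set (X × X)} (hZ : MeasurableSet Z) (L : testSpace a →ₗ[ℝ] ℝ)
    (hL : ∀ φ, L φ ≤ ∫ q, K q.1 q.2 * (if q ∈ Z then |nonlocalGrad φ.1 q.1 q.2| else 0)
      ∂(ν ⊗ₘ m)) :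
    ∃ k : X × X → ℝ, Measurable k ∧ (∀ q, |k q| ≤ 1) ∧ ∀ φ,
      L φ = ∫ q, K q.1 q.2 * (if q ∈ Z then k q else 0) * nonlocalGrad φ.1 q.1 q.2 ∂(ν ⊗ₘ m) := by
  set d : X × X → ℝ≥0 := fun q =>
    Real.toNNReal (K q.1 q.2 * (if q ∈ Z then a q.1 + a q.2 else 0)) with hd
  have hgm : Measurable (fun q : X × X => a q.1 + a q.2) :=
    (ha.measurable.comp measurable_fst).add (ha.measurable.comp measurable_snd)
  have hpos : ∀ q : X × X, 0 < a q.1 + a q.2 := fun q => add_pos (ha.pos _) (ha.pos _)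
  have hdm : Measurable d :=
    (hK.measurable.mul (Measurable.ite hZ hgm measurable_const)).real_toNNReal
  have hd0 : ∀ q, (d q : ℝ) = K q.1 q.2 * (if q ∈ Z then a q.1 + a q.2 else 0) := fun q =>
    Real.coe_toNNReal _ (mul_nonneg (hK.nonneg _ _) (by split_ifs; exacts [(hpos q).le, le_rfl]))
  have hdint : Integrable (fun q => (d q : ℝ)) (ν ⊗ₘ m) := by
    refine ((integrable_fst ha.integrable).add (integrable_snd hrev ha.integrable)).mono'
      hdm.coe_nnreal_real.aestronglyMeasurable (Eventually.of_forall fun q => ?_)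
    rw [Real.norm_of_nonneg (d q).coe_nonneg, hd0, Pi.add_apply]
    refine (mul_le_of_le_one_left ?_ (hK.le_one _ _)).trans ?_ <;> split_ifs
    exacts [(hpos q).le, le_rfl, le_rfl, (hpos q).le]
  set μ : Measure (X × X) := (ν ⊗ₘ m).withDensity fun q => (d q : ℝ≥0∞) with hμ
  have : IsFiniteMeasure μ := by
    refine isFiniteMeasure_withDensity ?_
    have := hdint.2
    rw [hasFiniteIntegral_iff_ofReal (Eventually.of_forall fun q => (d q).coe_nonneg)] at this
    simpa using this.ne
  have hTL : ∀ φ : testSpace a, MemLp (weightedGrad a φ) 2 μ := fun φ => by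
    obtain ⟨C, hC⟩ := abs_weightedGrad_le ha φ
    exact MemLp.of_bound (measurable_weightedGrad ha φ).aestronglyMeasurable C
      (Eventually.of_forall hC)
  obtain ⟨k, hkm, hk1, hk⟩ := exists_density_of_le_integral_abs_comp (weightedGrad a) hTL L
    (fun φ => by
      refine (hL φ).trans_eq ?_
      rw [hμ, integral_withDensity_eq_integral_smul hdm]
      refine integral_congr_ae (Eventually.of_forall fun q => ?_)
      simp only [NNReal.smul_def, smul_eq_mul, hd0, weightedGrad, LinearMap.coe_mk, AddHom.coe_mk]
      split_ifs
      · rw [abs_div, abs_of_pos (hpos q), mul_assoc, mul_div_cancel₀ _ (hpos q).ne']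
      · ring)
  refine ⟨k, hkm, hk1, fun φ => ?_⟩
  rw [hk, hμ, integral_withDensity_eq_integral_smul hdm]
  refine integral_congr_ae (Eventually.of_forall fun q => ?_)
  simp only [NNReal.smul_def, smul_eq_mul, hd0, weightedGrad, LinearMap.coe_mk, AddHom.coe_mk]
  split_ifs
  · have := (hpos q).ne'
    field_simp
  · ring

section ExistsFlux

variable [IsMarkovKernel m] [SigmaFinite ν]

theorem signFlux_bound {K₁ K₂ : X → X → ℝ} (hK₁ : IsSymmWeight K₁) (hK₂ : IsSymmWeight K₂) {p : ℝ}
    (hp : 1 < p) (u : X → ℝ) {z : ℝ} (hz : |z| ≤ 1) (q : X × X) :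
    |K₁ q.1 q.2 * z + K₂ q.1 q.2 * signedPow p (nonlocalGrad u q.1 q.2)|
      ≤ 2 + energyDensity K₂ p u q := by
  have h1 := abs_mul_signedPow_le hK₂ hp u q
  have h2 : |K₁ q.1 q.2 * z| ≤ 1 := by
    rw [abs_mul, abs_of_nonneg (hK₁.nonneg _ _)]
    exact mul_le_one₀ (hK₁.le_one _ _) (abs_nonneg _) hz
  linarith [abs_add_le (K₁ q.1 q.2 * z) (K₂ q.1 q.2 * signedPow p (nonlocalGrad u q.1 q.2))]

open Classical in
/-- Pairing a subgradient of `F₁ + F_p` with test functions: the part of the flux on `{∇u = 0}` is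
given by a function `k` with values in `[-1, 1]`. -/
theorem exists_density_of_subgradient (hrev : m.IsReversible ν) {K₁ K₂ : X → X → ℝ}
    (hK₁ : IsSymmWeight K₁) (hK₂ : IsSymmWeight K₂) {p : ℝ} (hp : 1 < p) {u v : Lp ℝ 2 ν}
    (hv : v ∈ subdifferential (fun w : Lp ℝ 2 ν =>
      ((weightedEnergy m ν K₁ 1 w + weightedEnergy m ν K₂ p w : ℝ≥0∞) : EReal)) u)
    {a : X → ℝ} (ha : IsTestWeight ν a) :
    ∃ k : X × X → ℝ, Measurable k ∧ (∀ q, |k q| ≤ 1) ∧ ∀ φ ∈ testSpace a,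
      2 * ∫ x, v x * φ x ∂ν = ∫ q, (K₁ q.1 q.2 *
          (nonlocalGrad u q.1 q.2 / |nonlocalGrad u q.1 q.2| +
            if nonlocalGrad u q.1 q.2 = 0 then k q else 0)
          + K₂ q.1 q.2 * signedPow p (nonlocalGrad u q.1 q.2)) * nonlocalGrad φ q.1 q.2
          ∂(ν ⊗ₘ m) := by
  have hp0 : 0 < p := by linarith
  have hum := measurable_Lp u
  have hgu := measurable_nonlocalGrad hum
  rw [mem_subdifferential_coe_iff] at hv
  obtain ⟨hu, hsub⟩ := hv
  obtain ⟨hu₁, hu₂⟩ := ENNReal.add_ne_top.1 hu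
  have hI₁ := (weightedEnergy_ne_top_iff hK₁ one_pos hum).1 hu₁
  have hI₂ := (weightedEnergy_ne_top_iff hK₂ hp0 hum).1 hu₂
  have hφ1 : ∀ φ ∈ testSpace a, Integrable φ ν := fun φ hφ => ha.integrable_of_mem hφ
  have hφ2 : ∀ φ ∈ testSpace a, MemLp φ 2 ν := fun φ hφ => by
    obtain ⟨C, -, hC⟩ := ha.exists_bound hφ
    exact memLp_two_of_integrable_of_bound (hφ1 φ hφ) (Eventually.of_forall fun x => (hC x).2)
  have hφE : ∀ φ ∈ testSpace a, ∀ {K : X → X → ℝ}, IsSymmWeight K → ∀ {r : ℝ}, 1 ≤ r →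
      Integrable (energyDensity K r φ) (ν ⊗ₘ m) := fun φ hφ K hK r hr => by
    obtain ⟨C, -, hC⟩ := ha.exists_bound hφ
    exact integrable_energyDensity_of_bound hrev hK hr hφ.1 (hφ1 φ hφ) fun x => (hC x).2
  set G : X × X → ℝ := fun q => K₁ q.1 q.2 *
    (nonlocalGrad u q.1 q.2 / |nonlocalGrad u q.1 q.2|)
      + K₂ q.1 q.2 * signedPow p (nonlocalGrad u q.1 q.2) with hG
  have hGint : ∀ φ ∈ testSpace a,
      Integrable (fun q : X × X => G q * nonlocalGrad φ q.1 q.2) (ν ⊗ₘ m) := fun φ hφ => by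
    simp only [hG, add_mul]
    refine Integrable.add ?_
      (integrable_signedPow_mul hK₂ hp hum hφ.1 hI₂ (hφE φ hφ hK₂ hp.le))
    refine (integrable_nonlocalGrad hrev (hφ1 φ hφ)).abs.mono' ((hK₁.measurable.mul
      (measurable_sign_nonlocalGrad hum)).mul (measurable_nonlocalGrad hφ.1)).aestronglyMeasurable
      (Eventually.of_forall fun q => ?_)
    rw [Real.norm_eq_abs, abs_mul]
    refine mul_le_of_le_one_left (abs_nonneg _) ?_
    rw [abs_mul, abs_of_nonneg (hK₁.nonneg _ _)]
    exact mul_le_one₀ (hK₁.le_one _ _) (abs_nonneg _) (abs_div_abs_le_one _)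
  have hvφ : ∀ φ ∈ testSpace a, Integrable (fun x => v x * φ x) ν := fun φ hφ =>
    (Lp.memLp v).integrable_mul (hφ2 φ hφ)
  let L : testSpace a →ₗ[ℝ] ℝ :=
    { toFun := fun φ => 2 * ∫ x, v x * φ.1 x ∂ν
        - ∫ q, G q * nonlocalGrad φ.1 q.1 q.2 ∂(ν ⊗ₘ m)
      map_add' := fun φ ψ => by
        have h1 : ∀ x, v x * (φ + ψ).1 x = v x * φ.1 x + v x * ψ.1 x := fun x => by
          simp only [Submodule.coe_add, Pi.add_apply]; ring
        have h2 : ∀ q : X × X, G q * nonlocalGrad (φ + ψ).1 q.1 q.2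
            = G q * nonlocalGrad φ.1 q.1 q.2 + G q * nonlocalGrad ψ.1 q.1 q.2 := fun q => by
          simp only [nonlocalGrad, Submodule.coe_add, Pi.add_apply]; ring
        simp_rw [h1, h2]
        rw [integral_add (hvφ _ φ.2) (hvφ _ ψ.2), integral_add (hGint _ φ.2) (hGint _ ψ.2)]
        ring
      map_smul' := fun c φ => by
        have h1 : ∀ x, v x * (c • φ).1 x = c * (v x * φ.1 x) := fun x => by
          simp only [Submodule.coe_smul, Pi.smul_apply, smul_eq_mul]; ring
        have h2 : ∀ q : X × X, G q * nonlocalGrad (c • φ).1 q.1 q.2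
            = c * (G q * nonlocalGrad φ.1 q.1 q.2) := fun q => by
          simp only [nonlocalGrad, Submodule.coe_smul, Pi.smul_apply, smul_eq_mul]; ring
        simp_rw [h1, h2]
        rw [integral_const_mul, integral_const_mul]
        simp only [smul_eq_mul, RingHom.id_apply]
        ring }
  have hZ : MeasurableSet {q : X × X | nonlocalGrad u q.1 q.2 = 0} :=
    hgu (measurableSet_singleton 0)
  obtain ⟨k, hkm, hk1, hk⟩ := exists_density_nonlocalGrad hrev hK₁ ha hZ L (fun φ => by
    have hφm : Measurable φ.1 := φ.2.1
    have h := two_mul_le_directional hrev hK₁ hK₂ hp hum hφm hI₁ hI₂ (hφ1 _ φ.2)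
      (hφE _ φ.2 hK₂ hp.le) (c := ∫ x, v x * φ.1 x ∂ν) (fun t _ => by
        set w : Lp ℝ 2 ν := u + t • (hφ2 _ φ.2).toLp with hw
        have hwae : w =ᵐ[ν] (u : X → ℝ) + t • φ.1 := by
          filter_upwards [Lp.coeFn_add u (t • (hφ2 _ φ.2).toLp),
            Lp.coeFn_smul t (hφ2 _ φ.2).toLp, (hφ2 _ φ.2).coeFn_toLp] with x h1 h2 h3
          rw [hw, h1, Pi.add_apply, h2, Pi.smul_apply, h3]; rfl
        have hm' : Measurable ((u : X → ℝ) + t • φ.1) := hum.add (hφm.const_smul t)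
        have hw₁ : weightedEnergy m ν K₁ 1 w ≠ ∞ := by
          rw [weightedEnergy_congr hrev K₁ 1 hwae, weightedEnergy_ne_top_iff hK₁ one_pos hm']
          exact integrable_energyDensity_add_smul hK₁ le_rfl hum hφm hI₁ (hφE _ φ.2 hK₁ le_rfl) t
        have hw₂ : weightedEnergy m ν K₂ p w ≠ ∞ := by
          rw [weightedEnergy_congr hrev K₂ p hwae, weightedEnergy_ne_top_iff hK₂ hp0 hm']
          exact integrable_energyDensity_add_smul hK₂ hp.le hum hφm hI₂ (hφE _ φ.2 hK₂ hp.le) t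
        have h := hsub w (ENNReal.add_ne_top.2 ⟨hw₁, hw₂⟩)
        rw [ENNReal.toReal_add hu₁ hu₂, ENNReal.toReal_add hw₁ hw₂,
          weightedEnergy_congr hrev K₁ 1 hwae, weightedEnergy_congr hrev K₂ p hwae,
          toReal_weightedEnergy hK₁ one_pos hum, toReal_weightedEnergy hK₂ hp0 hum,
          toReal_weightedEnergy hK₁ one_pos hm', toReal_weightedEnergy hK₂ hp0 hm', mul_one] at h
        have h4 : inner ℝ v (w - u) = t * ∫ x, v x * φ.1 x ∂ν := by
          rw [hw, add_sub_cancel_left, inner_smul_right, inner_Lp_eq]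
          congr 1
          refine integral_congr_ae ?_
          filter_upwards [(hφ2 _ φ.2).coeFn_toLp] with x hx
          rw [hx]
        rwa [h4] at h)
    simp only [L, LinearMap.coe_mk, AddHom.coe_mk, hG, Set.mem_ofPred_eq]
    linarith)
  refine ⟨k, hkm, hk1, fun φ hφ => ?_⟩
  have h := hk ⟨φ, hφ⟩
  simp only [L, LinearMap.coe_mk, AddHom.coe_mk, Set.mem_ofPred_eq] at h
  have hkint : Integrable (fun q : X × X => K₁ q.1 q.2 *
      (if nonlocalGrad u q.1 q.2 = 0 then k q else 0) * nonlocalGrad φ q.1 q.2) (ν ⊗ₘ m) := by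
    refine (integrable_nonlocalGrad hrev (hφ1 φ hφ)).abs.mono' ((hK₁.measurable.mul
      (Measurable.ite hZ hkm measurable_const)).mul
        (measurable_nonlocalGrad hφ.1)).aestronglyMeasurable (Eventually.of_forall fun q => ?_)
    rw [Real.norm_eq_abs, abs_mul]
    refine mul_le_of_le_one_left (abs_nonneg _) ?_
    rw [abs_mul, abs_of_nonneg (hK₁.nonneg _ _)]
    refine mul_le_one₀ (hK₁.le_one _ _) (abs_nonneg _) ?_
    split_ifs
    exacts [hk1 q, by simp]
  have h5 : 2 * ∫ x, v x * φ x ∂ν = ∫ q, G q * nonlocalGrad φ q.1 q.2 ∂(ν ⊗ₘ m)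
      + ∫ q, K₁ q.1 q.2 * (if nonlocalGrad u q.1 q.2 = 0 then k q else 0) *
        nonlocalGrad φ q.1 q.2 ∂(ν ⊗ₘ m) := by linarith
  rw [h5, ← integral_add (hGint φ hφ) hkint]
  refine integral_congr_ae (Eventually.of_forall fun q => ?_)
  simp only [hG]; ring

/-- Every subgradient of `F₁ + F_p` at `u` is minus the divergence of `K₁ z + K₂ |∇u| ^ (p - 2) ∇u`
for an antisymmetric `z ∈ sign(∇u)`. -/
theorem exists_flux_of_mem_subdifferential (hrev : m.IsReversible ν) {K₁ K₂ : X → X → ℝ}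
    (hK₁ : IsSymmWeight K₁) (hK₂ : IsSymmWeight K₂) {p : ℝ} (hp : 1 < p) {u v : Lp ℝ 2 ν}
    (hv : v ∈ subdifferential (fun w : Lp ℝ 2 ν =>
      ((weightedEnergy m ν K₁ 1 w + weightedEnergy m ν K₂ p w : ℝ≥0∞) : EReal)) u) :
    ∃ z : X → X → ℝ, Measurable (fun q : X × X => z q.1 q.2) ∧ (∀ x y, z y x = -z x y) ∧
      (∀ x y, |z x y| ≤ 1) ∧ (∀ x y, z x y * nonlocalGrad u x y = |nonlocalGrad u x y|) ∧
      ∀ᵐ x ∂ν, v x = -∫ y, (K₁ x y * z x y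
        + K₂ x y * signedPow p (nonlocalGrad u x y)) ∂(m x) := by
  classical
  have hp0 : 0 < p := by linarith
  have hum := measurable_Lp u
  have hgu := measurable_nonlocalGrad hum
  obtain ⟨a, ha⟩ := exists_isTestWeight ν
  obtain ⟨k, hkm, hk1, hk⟩ := exists_density_of_subgradient hrev hK₁ hK₂ hp hv ha
  have hI₂ : Integrable (energyDensity K₂ p u) (ν ⊗ₘ m) :=
    (weightedEnergy_ne_top_iff hK₂ hp0 hum).1
      (ENNReal.add_ne_top.1 (mem_subdifferential_coe_iff.1 hv).1).2
  set z₀ : X → X → ℝ := fun x y => nonlocalGrad u x y / |nonlocalGrad u x y|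
    + if nonlocalGrad u x y = 0 then k (x, y) else 0 with hz₀
  have hz₀m : Measurable (fun q : X × X => z₀ q.1 q.2) :=
    (measurable_sign_nonlocalGrad hum).add
      (Measurable.ite (hgu (measurableSet_singleton 0)) hkm measurable_const)
  have hz₀1 : ∀ x y, |z₀ x y| ≤ 1 := fun x y => by
    simp only [hz₀]
    split_ifs with h
    · simpa [h] using hk1 (x, y)
    · simpa using abs_div_abs_le_one (nonlocalGrad u x y)
  have hz₀u : ∀ x y, z₀ x y * nonlocalGrad u x y = |nonlocalGrad u x y| := fun x y => by
    simp only [hz₀]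
    split_ifs with h
    · simp [h]
    · rw [add_zero, div_mul_eq_mul_div, div_eq_iff (abs_ne_zero.2 h), abs_mul_abs_self]
  set z : X → X → ℝ := fun x y => (z₀ x y - z₀ y x) / 2 with hz
  have hzm : Measurable (fun q : X × X => z q.1 q.2) :=
    (hz₀m.sub (hz₀m.comp measurable_swap)).div_const 2
  have hanti : ∀ x y, z y x = -z x y := fun x y => by simp only [hz]; ring
  have hz1 : ∀ x y, |z x y| ≤ 1 := fun x y => by
    simp only [hz]
    rw [abs_div, abs_two, div_le_one two_pos]
    exact (abs_sub _ _).trans (by linarith [hz₀1 x y, hz₀1 y x])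
  have hzu : ∀ x y, z x y * nonlocalGrad u x y = |nonlocalGrad u x y| := fun x y => by
    have h1 := hz₀u x y
    have h2 := hz₀u y x
    rw [nonlocalGrad_antisymm u x y, abs_neg] at h2
    simp only [hz]
    linarith
  refine ⟨z, hzm, hanti, hz1, hzu, ?_⟩
  set G : X → X → ℝ := fun x y => K₁ x y * z x y + K₂ x y * signedPow p (nonlocalGrad u x y) with hG
  have hGm : Measurable (fun q : X × X => G q.1 q.2) :=
    (hK₁.measurable.mul hzm).add (measurable_mul_signedPow hK₂ p hum)
  have hGanti : ∀ x y, G y x = -G x y := fun x y => by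
    simp only [hG]
    rw [mul_signedPow_antisymm hK₂, hanti, hK₁.symm y x]; ring
  have hint : ∀ {ζ : X → X → ℝ}, Measurable (fun q : X × X => ζ q.1 q.2) →
      (∀ x y, |ζ x y| ≤ 1) → ∀ φ ∈ testSpace a, Integrable (fun q : X × X => φ q.1 *
        (K₁ q.1 q.2 * ζ q.1 q.2 + K₂ q.1 q.2 * signedPow p (nonlocalGrad u q.1 q.2)))
        (ν ⊗ₘ m) := fun {ζ} hζm hζ φ hφ => by
    obtain ⟨C, -, hC⟩ := ha.exists_bound hφ
    exact integrable_mul_of_bound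
      ((hK₁.measurable.mul hζm).add (measurable_mul_signedPow hK₂ p hum)) hI₂
      (fun q => signFlux_bound hK₁ hK₂ hp u (hζ _ _) q) hφ.1 (ha.integrable_of_mem hφ)
      (fun x => (hC x).2) (hK₂.energyDensity_nonneg p u)
  -- Replacing `z₀` by its antisymmetric part does not change the pairing with gradients.
  have hpair : ∀ φ ∈ testSpace a, ∫ x, v x * φ x ∂ν = ∫ x, φ x * (-∫ y, G x y ∂(m x)) ∂ν := by
    intro φ hφ
    have hφG := hint hzm hz1 φ hφ
    rw [integral_mul_div_of_integrable hrev hGanti hφG]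
    have h1 := hk φ hφ
    have hg0 : Integrable (fun q : X × X => (K₁ q.1 q.2 * z₀ q.1 q.2
        + K₂ q.1 q.2 * signedPow p (nonlocalGrad u q.1 q.2)) * nonlocalGrad φ q.1 q.2)
        (ν ⊗ₘ m) := by
      have h2 := hint hz₀m hz₀1 φ hφ
      have h3 := integrable_swap hrev (hint (ζ := fun x y => -z₀ y x)
        (hz₀m.comp measurable_swap).neg (fun x y => by rw [abs_neg]; exact hz₀1 y x) φ hφ)
      refine (h3.neg.sub h2).congr (Eventually.of_forall fun q => ?_)
      simp only [Pi.sub_apply, Pi.neg_apply, Prod.fst_swap, Prod.snd_swap]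
      rw [nonlocalGrad_antisymm u q.1 q.2, signedPow_neg, hK₁.symm q.2 q.1, hK₂.symm q.2 q.1]
      simp only [nonlocalGrad]; ring
    have h4 : ∫ q, G q.1 q.2 * nonlocalGrad φ q.1 q.2 ∂(ν ⊗ₘ m)
        = ∫ q, (K₁ q.1 q.2 * z₀ q.1 q.2
          + K₂ q.1 q.2 * signedPow p (nonlocalGrad u q.1 q.2)) * nonlocalGrad φ q.1 q.2
          ∂(ν ⊗ₘ m) := by
      set R : X × X → ℝ := fun q => (K₁ q.1 q.2 * z₀ q.1 q.2
          + K₂ q.1 q.2 * signedPow p (nonlocalGrad u q.1 q.2)) * nonlocalGrad φ q.1 q.2 with hR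
      have h5 : ∀ q : X × X, G q.1 q.2 * nonlocalGrad φ q.1 q.2
          = 1 / 2 * (R q + R q.swap) := fun q => by
        simp only [hR, hG, hz, Prod.fst_swap, Prod.snd_swap]
        rw [nonlocalGrad_antisymm u q.1 q.2, signedPow_neg, nonlocalGrad_antisymm φ q.1 q.2,
          hK₁.symm q.2 q.1, hK₂.symm q.2 q.1]
        ring
      simp_rw [h5]
      rw [integral_const_mul, integral_add hg0 (integrable_swap hrev hg0), integral_swap hrev R]
      ring
    rw [h4]
    linarith
  have haT : a ∈ testSpace a := ⟨ha.measurable, 1, fun x => by rw [abs_of_pos (ha.pos x), one_mul]⟩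
  have haL2 : MemLp a 2 ν := memLp_two_of_integrable_of_bound ha.integrable (C := 1)
    (Eventually.of_forall fun x => by rw [abs_of_pos (ha.pos x)]; exact ha.le_one x)
  have hva : Integrable (fun x => v x * a x) ν := (Lp.memLp v).integrable_mul haL2
  have hWa : Integrable (fun x => a x * (-∫ y, G x y ∂(m x))) ν := by
    have h := integrable_integral (hint hzm hz1 a haT)
    refine h.neg.congr (Eventually.of_forall fun x => ?_)
    simp only [Pi.neg_apply, integral_const_mul, mul_neg, hG]
  have hae : (fun x => v x * a x) =ᵐ[ν] fun x => a x * (-∫ y, G x y ∂(m x)) := by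
    refine hva.ae_eq_of_forall_setIntegral_eq _ _ hWa fun s hs _ => ?_
    have hsT : s.indicator a ∈ testSpace a := ⟨ha.measurable.indicator hs, 1, fun x => by
      rw [one_mul]
      by_cases hx : x ∈ s
      · rw [Set.indicator_of_mem hx, abs_of_pos (ha.pos x)]
      · rw [Set.indicator_of_notMem hx, abs_zero]; exact (ha.pos x).le⟩
    have h := hpair _ hsT
    rw [← integral_indicator hs, ← integral_indicator hs]
    convert h using 2 <;> ext x <;> by_cases hx : x ∈ s <;> simp [hx]
  filter_upwards [hae] with x hx
  rw [mul_comm] at hx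
  exact mul_left_cancel₀ (ha.pos x).ne' hx

end ExistsFlux

/-! ### Divergences in `L²` and the sum rule -/

section SumRule

variable [IsMarkovKernel m] [SigmaFinite ν]

theorem ae_integrable_section {f : X × X → ℝ} (hf : Integrable f (ν ⊗ₘ m)) :
    ∀ᵐ x ∂ν, Integrable (fun y => f (x, y)) (m x) :=
  ((Measure.integrable_compProd_iff hf.1).1 hf).1

omit [SigmaFinite ν] in
theorem stronglyMeasurable_integral {f : X × X → ℝ} (hf : Measurable f) :
    StronglyMeasurable (fun x => ∫ y, f (x, y) ∂(m x)) :=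
  hf.stronglyMeasurable.integral_kernel_prod_right'

omit [SigmaFinite ν] in
theorem abs_integral_le_of_ae_bound {f : X → ℝ} {x : X} {C : ℝ} (hf : ∀ᵐ y ∂(m x), |f y| ≤ C) :
    |∫ y, f y ∂(m x)| ≤ C := by
  have h := norm_integral_le_of_norm_le_const (f := f) (μ := m x) (C := C) (by simpa using hf)
  simpa using h

/-- The divergence of a bounded integrable flux is in `L²`. -/
theorem memLp_integral_of_integrable_of_bound {G : X × X → ℝ} (hG : Integrable G (ν ⊗ₘ m)) {C : ℝ}
    (hC : ∀ᵐ q ∂(ν ⊗ₘ m), |G q| ≤ C) : MemLp (fun x => ∫ y, G (x, y) ∂(m x)) 2 ν := by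
  refine memLp_two_of_integrable_of_bound (integrable_integral hG) (C := C) ?_
  filter_upwards [Measure.ae_ae_of_ae_compProd hC] with x hx
  exact abs_integral_le_of_ae_bound hx

/-- Averaging along the random walk maps `L²` to `L²`. -/
theorem memLp_integral_abs (hrev : m.IsReversible ν) {f : X → ℝ} (hfm : Measurable f)
    (hf : MemLp f 2 ν) :
    (∀ᵐ x ∂ν, Integrable f (m x)) ∧ MemLp (fun x => ∫ y, |f y| ∂(m x)) 2 ν := by
  have hsq : Integrable (fun q : X × X => f q.2 ^ 2) (ν ⊗ₘ m) :=
    integrable_snd hrev ((memLp_two_iff_integrable_sq hf.1).1 hf)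
  have h2 : ∀ᵐ x ∂ν, MemLp f 2 (m x) := by
    filter_upwards [ae_integrable_section hsq] with x hx
    exact (memLp_two_iff_integrable_sq hfm.aestronglyMeasurable).2 hx
  refine ⟨h2.mono fun x hx => hx.integrable (by norm_num), ?_⟩
  have hm : StronglyMeasurable (fun x => ∫ y, |f y| ∂(m x)) :=
    stronglyMeasurable_integral (f := fun q : X × X => |f q.2|) (hfm.comp measurable_snd).abs
  rw [memLp_two_iff_integrable_sq hm.aestronglyMeasurable]
  refine (integrable_integral hsq).mono' (hm.pow 2).aestronglyMeasurable ?_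
  filter_upwards [h2] with x hx
  have h3 := variance_nonneg |f| (m x)
  rw [variance_eq_sub hx.abs] at h3
  simp only [Pi.pow_apply, Pi.abs_apply, sq_abs] at h3
  rw [Real.norm_of_nonneg (sq_nonneg _)]
  linarith

theorem ae_integrable_signedPow {K : X → X → ℝ} (hK : IsSymmWeight K) {p : ℝ} (hp : 1 < p)
    {u : X → ℝ} (hu : Measurable u) (hI : Integrable (energyDensity K p u) (ν ⊗ₘ m)) :
    ∀ᵐ x ∂ν, Integrable (fun y => K x y * signedPow p (nonlocalGrad u x y)) (m x) := by
  filter_upwards [ae_integrable_section hI] with x hx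
  exact ((integrable_const (1 : ℝ)).add hx).mono'
    ((measurable_mul_signedPow hK p hu).comp measurable_prodMk_left).aestronglyMeasurable
    (Eventually.of_forall fun y => abs_mul_signedPow_le hK hp u (x, y))

/-- When `p ≥ 2`, the divergence of `K |∇u| ^ (p - 2) ∇u` lies in `L² + L¹`, because
`t ^ (p - 1) ≤ t + t ^ p`. -/
theorem exists_bound_integral_signedPow (hrev : m.IsReversible ν) {K : X → X → ℝ}
    (hK : IsSymmWeight K) {p : ℝ} (hp : 2 ≤ p) {u : X → ℝ} (hum : Measurable u) (hu : MemLp u 2 ν)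
    (hI : Integrable (energyDensity K p u) (ν ⊗ₘ m)) :
    ∃ g h : X → ℝ, MemLp g 2 ν ∧ Integrable h ν ∧
      ∀ᵐ x ∂ν, |∫ y, K x y * signedPow p (nonlocalGrad u x y) ∂(m x)| ≤ g x + h x := by
  have hp1 : 1 < p := by linarith
  obtain ⟨hP1, hP2⟩ := memLp_integral_abs hrev hum hu
  refine ⟨fun x => |u x| + ∫ y, |u y| ∂(m x), fun x => ∫ y, energyDensity K p u (x, y) ∂(m x),
    hu.abs.add hP2, integrable_integral hI, ?_⟩
  filter_upwards [hP1, ae_integrable_section hI, ae_integrable_signedPow hK hp1 hum hI]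
    with x h1 h2 h3
  have hconst : ∫ _, |u x| ∂(m x) = |u x| := by simp
  have hsum : Integrable (fun y => |u x| + |u y|) (m x) := (integrable_const _).add h1.abs
  rw [← hconst, ← integral_add (integrable_const _) h1.abs, ← integral_add hsum h2]
  refine abs_integral_le_integral_abs.trans (integral_mono h3.abs
    (hsum.add h2) fun y => ?_)
  simp only [energyDensity]
  rw [abs_mul, abs_of_nonneg (hK.nonneg _ _), abs_signedPow hp1]
  have h4 := mul_le_mul_of_nonneg_left
    (rpow_sub_one_le_add hp (abs_nonneg (nonlocalGrad u x y))) (hK.nonneg x y)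
  have h5 := mul_le_of_le_one_left (abs_nonneg (nonlocalGrad u x y)) (hK.le_one x y)
  have h6 : |nonlocalGrad u x y| ≤ |u y| + |u x| := abs_sub _ _
  linarith

theorem sq_le_of_abs_le_add {w g h : ℝ} (h1 : |w| ≤ 1) (h2 : |w| ≤ g + h) :
    w ^ 2 ≤ 2 * g ^ 2 + 2 * |h| := by
  have h3 : |w| ≤ |g| + |h| := h2.trans (add_le_add (le_abs_self _) (le_abs_self _))
  rw [← sq_abs w, ← sq_abs g]
  have := abs_nonneg w
  have := abs_nonneg g
  have := abs_nonneg h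
  rcases le_total |h| 1 with h4 | h4
  · nlinarith [sq_nonneg (|g| - |h|)]
  · nlinarith

/-- In a decomposition `v = -div (K₁ z) - div (K₂ |∇u| ^ (p - 2) ∇u)` of `v ∈ L²` with `|z| ≤ 1`,
the first term is in `L²`: it is bounded, and for `p ≥ 2` it also lies in `L² + L¹`. -/
theorem memLp_integral_sign_flux (hrev : m.IsReversible ν) {K₁ K₂ : X → X → ℝ}
    (hK₁ : IsSymmWeight K₁) (hK₂ : IsSymmWeight K₂) {p : ℝ} (hp : 1 < p)
    (hcond : ν Set.univ < ∞ ∨ 2 ≤ p) {u v : Lp ℝ 2 ν} {z : X → X → ℝ}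
    (hI : Integrable (energyDensity K₂ p u) (ν ⊗ₘ m))
    (hzm : Measurable (fun q : X × X => z q.1 q.2)) (hz : ∀ x y, |z x y| ≤ 1)
    (hv : ∀ᵐ x ∂ν, v x = -∫ y, (K₁ x y * z x y
        + K₂ x y * signedPow p (nonlocalGrad u x y)) ∂(m x)) :
    MemLp (fun x => -∫ y, K₁ x y * z x y ∂(m x)) 2 ν ∧
      ∀ᵐ x ∂ν, v x = -(∫ y, K₁ x y * z x y ∂(m x))
        - ∫ y, K₂ x y * signedPow p (nonlocalGrad u x y) ∂(m x) := by
  have hum := measurable_Lp u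
  have hKz : ∀ x y, |K₁ x y * z x y| ≤ 1 := fun x y => by
    rw [abs_mul, abs_of_nonneg (hK₁.nonneg _ _)]
    exact mul_le_one₀ (hK₁.le_one _ _) (abs_nonneg _) (hz _ _)
  have hKzm : Measurable (fun q : X × X => K₁ q.1 q.2 * z q.1 q.2) := hK₁.measurable.mul hzm
  have hsplit : ∀ᵐ x ∂ν, v x = -(∫ y, K₁ x y * z x y ∂(m x))
        - ∫ y, K₂ x y * signedPow p (nonlocalGrad u x y) ∂(m x) := by
    filter_upwards [hv, ae_integrable_signedPow hK₂ hp hum hI] with x h1 h2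
    rw [h1, integral_add _ h2, neg_add, sub_eq_add_neg]
    exact (integrable_const (1 : ℝ)).mono'
      (hKzm.comp measurable_prodMk_left).aestronglyMeasurable
      (Eventually.of_forall fun y => hKz x y)
  refine ⟨?_, hsplit⟩
  have hm : StronglyMeasurable (fun x => -∫ y, K₁ x y * z x y ∂(m x)) :=
    (stronglyMeasurable_integral hKzm).neg
  have hbound : ∀ x, |-∫ y, K₁ x y * z x y ∂(m x)| ≤ 1 := fun x => by
    rw [abs_neg]
    exact abs_integral_le_of_ae_bound (Eventually.of_forall (hKz x))
  rcases hcond with hfin | hp2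
  · have : IsFiniteMeasure ν := ⟨hfin⟩
    exact MemLp.of_bound hm.aestronglyMeasurable 1 (Eventually.of_forall hbound)
  · obtain ⟨g, h, hg, hh, hgh⟩ :=
      exists_bound_integral_signedPow hrev hK₂ hp2 hum (Lp.memLp u) hI
    have hvg : MemLp (fun x => |v x| + g x) 2 ν := (Lp.memLp v).abs.add hg
    rw [memLp_two_iff_integrable_sq hm.aestronglyMeasurable]
    refine ((((memLp_two_iff_integrable_sq hvg.1).1 hvg).const_mul 2).add
      (hh.abs.const_mul 2)).mono' (hm.pow 2).aestronglyMeasurable ?_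
    filter_upwards [hsplit, hgh] with x h1 h2
    rw [Real.norm_of_nonneg (sq_nonneg _)]
    refine sq_le_of_abs_le_add (hbound x) ?_
    rw [show -(∫ y, K₁ x y * z x y ∂(m x))
      = v x + ∫ y, K₂ x y * signedPow p (nonlocalGrad u x y) ∂(m x) by linarith]
    linarith [abs_add_le (v x) (∫ y, K₂ x y * signedPow p (nonlocalGrad u x y) ∂(m x))]

/-- The sum rule: a subgradient of `F₁ + F_p` splits into subgradients of `F₁` and `F_p`. -/
theorem exists_add_of_mem_subdifferential_add (hrev : m.IsReversible ν) {K₁ K₂ : X → X → ℝ}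
    (hK₁ : IsSymmWeight K₁) (hK₂ : IsSymmWeight K₂) {p : ℝ} (hp : 1 < p)
    (hcond : ν Set.univ < ∞ ∨ 2 ≤ p) {u v : Lp ℝ 2 ν}
    (hv : v ∈ subdifferential (fun w : Lp ℝ 2 ν =>
      ((weightedEnergy m ν K₁ 1 w + weightedEnergy m ν K₂ p w : ℝ≥0∞) : EReal)) u) :
    ∃ v₁ ∈ subdifferential (fun w : Lp ℝ 2 ν => (weightedEnergy m ν K₁ 1 w : EReal)) u,
      ∃ v₂ ∈ subdifferential (fun w : Lp ℝ 2 ν => (weightedEnergy m ν K₂ p w : EReal)) u,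
        v₁ + v₂ = v := by
  obtain ⟨hu₁, hu₂⟩ := ENNReal.add_ne_top.1 (mem_subdifferential_coe_iff.1 hv).1
  have hI := (weightedEnergy_ne_top_iff hK₂ (by linarith) (measurable_Lp u)).1 hu₂
  obtain ⟨z, hzm, hanti, hz, hzu, hvz⟩ :=
    exists_flux_of_mem_subdifferential hrev hK₁ hK₂ hp hv
  obtain ⟨hW, hsplit⟩ := memLp_integral_sign_flux hrev hK₁ hK₂ hp hcond hI hzm hz hvz
  refine ⟨hW.toLp, mem_subdifferential_one_of_flux hrev hK₁ hu₁ hzm hanti hz hzu hW.coeFn_toLp,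
    v - hW.toLp, mem_subdifferential_of_signedPow_flux hrev hK₂ hp hu₂ ?_, add_sub_cancel _ _⟩
  filter_upwards [Lp.coeFn_sub v hW.toLp, hW.coeFn_toLp, hsplit] with x h1 h2 h3
  rw [h1, Pi.sub_apply, h2, h3]
  ring

theorem isSymmWeight_zero : IsSymmWeight (fun _ _ : X => (0 : ℝ)) where
  measurable := measurable_const
  symm _ _ := rfl
  nonneg _ _ := le_rfl
  le_one _ _ := zero_le_one

/-- The subdifferential of the `p`-energy is single-valued, given by the divergence of
`K |∇u| ^ (p - 2) ∇u`. -/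
theorem mem_subdifferential_weightedEnergy_iff (hrev : m.IsReversible ν) {K : X → X → ℝ}
    (hK : IsSymmWeight K) {p : ℝ} (hp : 1 < p) {u v : Lp ℝ 2 ν} :
    v ∈ subdifferential (fun w : Lp ℝ 2 ν => (weightedEnergy m ν K p w : EReal)) u ↔
      Integrable (energyDensity K p u) (ν ⊗ₘ m) ∧
        ∀ᵐ x ∂ν, v x = -∫ y, K x y * signedPow p (nonlocalGrad u x y) ∂(m x) := by
  rw [← weightedEnergy_ne_top_iff hK (by linarith) (measurable_Lp u)]
  refine ⟨fun hv => ⟨(mem_subdifferential_coe_iff.1 hv).1, ?_⟩,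
    fun h => mem_subdifferential_of_signedPow_flux hrev hK hp h.1 h.2⟩
  have h0 : ∀ w : Lp ℝ 2 ν, weightedEnergy m ν (fun _ _ => 0) 1 w = 0 := fun w => by
    simp [weightedEnergy]
  obtain ⟨z, -, -, -, -, hvz⟩ := exists_flux_of_mem_subdifferential hrev isSymmWeight_zero hK hp
    (u := u) (v := v) (by simpa only [h0, zero_add] using hv)
  simpa only [zero_mul, zero_add] using hvz

omit [IsMarkovKernel m] in
theorem mDiv_mul_signedPow {K : X → X → ℝ} (hK : IsSymmWeight K) (p : ℝ) (u : X → ℝ) (x : X) :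
    mDiv m (fun x y => K x y * (|nonlocalGrad u x y| ^ (p - 2) * nonlocalGrad u x y)) x
      = ∫ y, K x y * signedPow p (nonlocalGrad u x y) ∂(m x) := by
  have h : ∀ y, K x y * (|nonlocalGrad u x y| ^ (p - 2) * nonlocalGrad u x y)
      - K y x * (|nonlocalGrad u y x| ^ (p - 2) * nonlocalGrad u y x)
      = 2 * (K x y * signedPow p (nonlocalGrad u x y)) := fun y => by
    have := mul_signedPow_antisymm hK p u x y
    simp only [signedPow] at this ⊢
    linarith
  unfold mDiv
  simp_rw [h]
  rw [integral_const_mul]; ring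

end SumRule

/-! ### Density of the domain -/

section Density

variable [IsMarkovKernel m] [SigmaFinite ν]

/-- At a bounded function with support of finite measure, the fluxes `sign(∇u)` and
`|∇u| ^ (p - 2) ∇u` have divergence in `L²`. -/
theorem exists_mem_subdifferential_add (hrev : m.IsReversible ν) {K₁ K₂ : X → X → ℝ}
    (hK₁ : IsSymmWeight K₁) (hK₂ : IsSymmWeight K₂) {p : ℝ} (hp : 1 < p) {u : Lp ℝ 2 ν}
    {f : X → ℝ} (huf : u =ᵐ[ν] f) (hfm : Measurable f) {C : ℝ} (hC : ∀ x, |f x| ≤ C)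
    (hf : ν (Function.support f) < ∞) :
    (subdifferential (fun w : Lp ℝ 2 ν =>
      ((weightedEnergy m ν K₁ 1 w + weightedEnergy m ν K₂ p w : ℝ≥0∞) : EReal)) u).Nonempty := by
  have hp0 : 0 < p := by linarith
  have hum := measurable_Lp u
  have hgrad := nonlocalGrad_congr_ae (m := m) hrev huf
  set S := Function.support f with hS
  have hSm : MeasurableSet S := measurableSet_support hfm
  have hSint : Integrable (S.indicator (fun _ => (1 : ℝ))) ν :=
    (integrable_indicator_iff hSm).2 (integrableOn_const hf.ne)
  have hfint : Integrable f ν := by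
    refine (hSint.const_mul C).mono' hfm.aestronglyMeasurable (Eventually.of_forall fun x => ?_)
    by_cases hx : x ∈ S
    · simpa [hx] using hC x
    · simp [hx, Function.notMem_support.1 hx]
  have hI : ∀ {K : X → X → ℝ}, IsSymmWeight K → ∀ {r : ℝ}, 1 ≤ r →
      weightedEnergy m ν K r u ≠ ∞ := fun hK r hr => by
    rw [weightedEnergy_congr hrev _ _ huf, weightedEnergy_ne_top_iff hK (by linarith) hfm]
    exact integrable_energyDensity_of_bound hrev hK hr hfm hfint hC
  set B : X × X → ℝ := fun q => S.indicator (fun _ => (1 : ℝ)) q.1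
    + S.indicator (fun _ => (1 : ℝ)) q.2 with hB
  have hBint : Integrable B (ν ⊗ₘ m) := (integrable_fst hSint).add (integrable_snd hrev hSint)
  -- A flux bounded by `c` that vanishes where `∇u = 0` is dominated by a multiple of `B`.
  have key : ∀ {G : X × X → ℝ} {c : ℝ}, Measurable G → 0 ≤ c →
      (∀ᵐ q ∂(ν ⊗ₘ m), |G q| ≤ c) → (∀ q : X × X, nonlocalGrad u q.1 q.2 = 0 → G q = 0) →
      MemLp (fun x => -∫ y, G (x, y) ∂(m x)) 2 ν := fun {G c} hGm hc0 hGc hG0 => by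
    refine (memLp_integral_of_integrable_of_bound ((hBint.const_mul c).mono'
      hGm.aestronglyMeasurable ?_) hGc).neg
    filter_upwards [hGc, hgrad] with q h1 h2
    have hB0 : 0 ≤ B q := add_nonneg (Set.indicator_nonneg (fun _ _ => zero_le_one) _)
      (Set.indicator_nonneg (fun _ _ => zero_le_one) _)
    by_cases hq : nonlocalGrad f q.1 q.2 = 0
    · rw [hG0 q (h2.trans hq), norm_zero]; positivity
    · have hB1 : 1 ≤ B q := by
        by_cases h3 : q.1 ∈ S <;> by_cases h4 : q.2 ∈ S
        · simp [hB, h3, h4]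
        · simp [hB, h3, h4]
        · simp [hB, h3, h4]
        · exact absurd (by simp [nonlocalGrad, Function.notMem_support.1 h3,
            Function.notMem_support.1 h4]) hq
      exact h1.trans (le_mul_of_one_le_right hc0 hB1)
  set z : X → X → ℝ := fun x y => nonlocalGrad u x y / |nonlocalGrad u x y| with hz
  have hz1 : ∀ x y, |z x y| ≤ 1 := fun x y => abs_div_abs_le_one _
  have hW₁ := key (hK₁.measurable.mul (measurable_sign_nonlocalGrad hum)) zero_le_one
    (Eventually.of_forall fun q => by
      rw [Pi.mul_apply, abs_mul, abs_of_nonneg (hK₁.nonneg _ _)]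
      exact mul_le_one₀ (hK₁.le_one _ _) (abs_nonneg _) (hz1 _ _))
    (fun q hq => by simp [hq])
  have hW₂ := key (measurable_mul_signedPow hK₂ p hum)
    (c := |2 * C| ^ (p - 1)) (by positivity) (by
      filter_upwards [hgrad] with q hq
      rw [abs_mul, abs_of_nonneg (hK₂.nonneg _ _), abs_signedPow hp, hq]
      refine (mul_le_of_le_one_left (by positivity) (hK₂.le_one _ _)).trans
        (Real.rpow_le_rpow (abs_nonneg _) ?_ (by linarith))
      exact (abs_nonlocalGrad_le hC _ _).trans (le_abs_self _))
    (fun q hq => by simp [hq, signedPow])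
  refine ⟨hW₁.toLp + hW₂.toLp, add_subset_subdifferential_add
    (mem_subdifferential_one_of_flux hrev hK₁ (hI hK₁ le_rfl) (measurable_sign_nonlocalGrad hum)
      (z := z) (fun x y => ?_) hz1 (fun x y => ?_) hW₁.coeFn_toLp)
    (mem_subdifferential_of_signedPow_flux hrev hK₂ hp (hI hK₂ hp.le) hW₂.coeFn_toLp)⟩
  · simp only [hz]
    rw [nonlocalGrad_antisymm u x y, abs_neg, neg_div]
  · simp only [hz]
    rcases eq_or_ne (nonlocalGrad u x y) 0 with h | h
    · simp [h]
    · rw [div_mul_eq_mul_div, div_eq_iff (abs_ne_zero.2 h), abs_mul_abs_self]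

theorem dense_opDomain_subdifferential_add (hrev : m.IsReversible ν) {K₁ K₂ : X → X → ℝ}
    (hK₁ : IsSymmWeight K₁) (hK₂ : IsSymmWeight K₂) {p : ℝ} (hp : 1 < p) :
    Dense (opDomain (subdifferential (fun w : Lp ℝ 2 ν =>
      ((weightedEnergy m ν K₁ 1 w + weightedEnergy m ν K₂ p w : ℝ≥0∞) : EReal)))) := by
  refine (Lp.simpleFunc.dense (E := ℝ) (p := 2) (μ := ν) (by norm_num)).mono fun u hu => ?_
  set s := Lp.simpleFunc.toSimpleFunc (⟨u, hu⟩ : Lp.simpleFunc ℝ 2 ν) with hs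
  have hsu : s =ᵐ[ν] u := Lp.simpleFunc.toSimpleFunc_eq_toFun (⟨u, hu⟩ : Lp.simpleFunc ℝ 2 ν)
  have hmem : MemLp s 2 ν := (memLp_congr_ae hsu).2 (Lp.memLp u)
  obtain ⟨C, hC⟩ := s.exists_forall_norm_le
  exact exists_mem_subdifferential_add hrev hK₁ hK₂ hp hsu.symm s.measurable hC
    (SimpleFunc.measure_support_lt_top_of_memLp s hmem (by norm_num) (by norm_num))

end Density

/-! ### Moreau envelopes of functions in `J₀` -/

/-- Firmly nonexpansive functions with `q 0 = 0`: the nondecreasing `1`-Lipschitz functions that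
vanish at `0`. -/
structure IsFirmContraction (q : ℝ → ℝ) : Prop where
  zero : q 0 = 0
  firm : ∀ r s, (q r - q s) ^ 2 ≤ (q r - q s) * (r - s)

namespace IsFirmContraction

variable {q : ℝ → ℝ} (hq : IsFirmContraction q)
include hq

theorem abs_sub_le (r s : ℝ) : |q r - q s| ≤ |r - s| := by
  have h1 := hq.firm r s
  have h2 : (q r - q s) * (r - s) ≤ |q r - q s| * |r - s| := by
    rw [← abs_mul]; exact le_abs_self _
  rw [← sq_abs] at h1
  rcases (abs_nonneg (q r - q s)).eq_or_lt with h | h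
  · rw [← h]; exact abs_nonneg _
  · nlinarith

theorem abs_le (r : ℝ) : |q r| ≤ |r| := by
  simpa [hq.zero] using hq.abs_sub_le r 0

theorem continuous : Continuous q :=
  (LipschitzWith.of_dist_le_mul (K := 1) fun r s => by
    simpa [Real.dist_eq] using hq.abs_sub_le r s).continuous

theorem exists_eq_mul (r s : ℝ) : ∃ θ, 0 ≤ θ ∧ θ ≤ 1 ∧ q r - q s = θ * (r - s) := by
  have h := hq.firm r s
  rcases eq_or_ne (r - s) 0 with h0 | h0
  · refine ⟨0, le_rfl, zero_le_one, ?_⟩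
    rw [h0, mul_zero] at h
    rw [zero_mul]
    exact pow_eq_zero_iff two_ne_zero |>.1 (le_antisymm h (sq_nonneg _))
  · have hpos : 0 < (r - s) ^ 2 := by positivity
    have hle := hq.abs_sub_le r s
    refine ⟨(q r - q s) / (r - s), ?_, ?_, (div_mul_cancel₀ _ h0).symm⟩
    · rw [show (q r - q s) / (r - s) = (q r - q s) * (r - s) / (r - s) ^ 2 by field_simp]
      exact div_nonneg ((sq_nonneg _).trans h) hpos.le
    · refine (le_abs_self _).trans ?_
      rw [abs_div]
      exact div_le_one_of_le₀ hle (abs_nonneg _)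

end IsFirmContraction

theorem exists_isMinOn_envelope {j : ℝ → ℝ≥0∞} (hj : LowerSemicontinuous j) {n : ℝ} (hn : 0 < n)
    (hj0 : j 0 = 0) (r : ℝ) :
    ∃ s, ∀ t, j s + ENNReal.ofReal (n / 2 * (r - s) ^ 2)
      ≤ j t + ENNReal.ofReal (n / 2 * (r - t) ^ 2) := by
  set E : ℝ → ℝ≥0∞ := fun t => j t + ENNReal.ofReal (n / 2 * (r - t) ^ 2) with hE
  have hcont : Continuous fun t : ℝ => ENNReal.ofReal (n / 2 * (r - t) ^ 2) :=
    ENNReal.continuous_ofReal.comp (by fun_prop)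
  have hlsc : LowerSemicontinuous E := hj.add hcont.lowerSemicontinuous
  have h0mem : (0 : ℝ) ∈ Metric.closedBall r |r| := by simp
  obtain ⟨s, -, hs⟩ := (hlsc.lowerSemicontinuousOn _).exists_isMinOn ⟨0, h0mem⟩
    (isCompact_closedBall r |r|)
  refine ⟨s, fun t => ?_⟩
  by_cases ht : t ∈ Metric.closedBall r |r|
  · exact hs ht
  · refine (hs h0mem).trans ?_
    simp only [hE, hj0, zero_add, sub_zero]
    refine le_add_left (ENNReal.ofReal_le_ofReal (mul_le_mul_of_nonneg_left ?_ (by positivity)))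
    rw [Metric.mem_closedBall, Real.dist_eq, not_le, abs_sub_comm] at ht
    exact sq_le_sq.2 ht.le

/-- The Moreau envelope of `j ∈ J₀` with parameter `n`: a finite function `e ≤ j` with subgradient
`n q`, where `q = id - prox` is firmly nonexpansive. The last clause makes `e` close to `j` for
large `n`. -/
theorem exists_envelope {j : ℝ → ℝ≥0∞} (hj : j ∈ J0) {n : ℝ} (hn : 0 < n) :
    ∃ e q : ℝ → ℝ, IsFirmContraction q ∧ (∀ r, 0 ≤ e r) ∧ (∀ r, e r ≤ n / 2 * r ^ 2) ∧
      (∀ r, ENNReal.ofReal (e r) ≤ j r) ∧ (∀ r s, e r + n * (q r * (s - r)) ≤ e s) ∧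
      ∀ r, ∃ s, j s ≤ ENNReal.ofReal (e r) ∧ n / 2 * (r - s) ^ 2 ≤ e r := by
  obtain ⟨hconv, hlsc, hj0⟩ := hj
  choose P hP using exists_isMinOn_envelope hlsc hn hj0
  have hfin : ∀ r, j (P r) ≠ ∞ := fun r h => by
    have := hP r 0
    rw [h, top_add, hj0, zero_add] at this
    exact ENNReal.ofReal_ne_top (top_le_iff.1 this)
  set J : ℝ → ℝ := fun s => (j s).toReal with hJ
  have hJ0 : ∀ s, 0 ≤ J s := fun s => ENNReal.toReal_nonneg
  have hminE : ∀ r t, j t ≠ ∞ → J (P r) + n / 2 * (r - P r) ^ 2 ≤ J t + n / 2 * (r - t) ^ 2 := by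
    intro r t ht
    have h := ENNReal.toReal_mono (ENNReal.add_ne_top.2 ⟨ht, ENNReal.ofReal_ne_top⟩) (hP r t)
    rwa [ENNReal.toReal_add (hfin r) ENNReal.ofReal_ne_top,
      ENNReal.toReal_add ht ENNReal.ofReal_ne_top, ENNReal.toReal_ofReal (by positivity),
      ENNReal.toReal_ofReal (by positivity)] at h
  have hJconv : ∀ s t θ : ℝ, j s ≠ ∞ → j t ≠ ∞ → 0 ≤ θ → θ ≤ 1 →
      j (s + θ * (t - s)) ≠ ∞ ∧ J (s + θ * (t - s)) ≤ (1 - θ) * J s + θ * J t := by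
    intro s t θ hs ht h0 h1
    have h := hconv.2 (Set.mem_univ s) (Set.mem_univ t)
      (zero_le (a := Real.toNNReal (1 - θ))) (zero_le (a := Real.toNNReal θ)) (by
        rw [← Real.toNNReal_add (sub_nonneg.2 h1) h0]; simp)
    simp only [NNReal.smul_def, Real.coe_toNNReal _ h0, Real.coe_toNNReal _ (sub_nonneg.2 h1),
      ENNReal.smul_def, smul_eq_mul] at h
    rw [show (1 - θ) * s + θ * t = s + θ * (t - s) by ring] at h
    have hr : (Real.toNNReal (1 - θ) : ℝ≥0∞) * j s + (Real.toNNReal θ : ℝ≥0∞) * j t ≠ ∞ :=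
      ENNReal.add_ne_top.2 ⟨ENNReal.mul_ne_top ENNReal.coe_ne_top hs,
        ENNReal.mul_ne_top ENNReal.coe_ne_top ht⟩
    refine ⟨ne_top_of_le_ne_top hr h, ?_⟩
    have h2 := ENNReal.toReal_mono hr h
    rwa [ENNReal.toReal_add (ENNReal.mul_ne_top ENNReal.coe_ne_top hs)
      (ENNReal.mul_ne_top ENNReal.coe_ne_top ht), ENNReal.toReal_mul, ENNReal.toReal_mul,
      ENNReal.coe_toReal, ENNReal.coe_toReal, Real.coe_toNNReal _ h0,
      Real.coe_toNNReal _ (sub_nonneg.2 h1)] at h2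
  -- `n (r - P r)` is a subgradient of `j` at `P r`.
  have hsub : ∀ r t, j t ≠ ∞ → J (P r) + n * (r - P r) * (t - P r) ≤ J t := by
    intro r t ht
    refine le_of_forall_pos_le_add fun ε hε => ?_
    set c := n / 2 * (t - P r) ^ 2 with hc
    have hc0 : 0 ≤ c := by positivity
    set θ := min 1 (ε / (c + 1)) with hθ
    have hθ0 : 0 < θ := lt_min one_pos (by positivity)
    have hθ1 : θ ≤ 1 := min_le_left _ _
    have hθc : θ * c ≤ ε := by
      have h1 : θ ≤ ε / (c + 1) := min_le_right _ _
      rw [le_div_iff₀ (by positivity)] at h1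
      nlinarith
    obtain ⟨h1, h2⟩ := hJconv (P r) t θ (hfin r) ht hθ0.le hθ1
    have h3 := hminE r _ h1
    have h4 : θ * (J (P r) + n * (r - P r) * (t - P r)) ≤ θ * (J t + θ * c) := by
      rw [hc]; nlinarith
    linarith [le_of_mul_le_mul_left h4 hθ0]
  refine ⟨fun r => J (P r) + n / 2 * (r - P r) ^ 2, fun r => r - P r, ⟨?_, fun r s => ?_⟩,
    fun r => ?_, fun r => ?_, fun r => ?_, fun r s => ?_, fun r => ⟨P r, ?_, ?_⟩⟩
  · have h := hminE 0 0 (by rw [hj0]; exact ENNReal.zero_ne_top)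
    simp only [hJ, hj0, ENNReal.toReal_zero, sub_self, zero_sub] at h ⊢
    have h1 : n / 2 * (-P 0) ^ 2 ≤ 0 := by linarith [hJ0 (P 0)]
    have h2 : (-P 0) ^ 2 ≤ 0 := nonpos_of_mul_nonpos_right h1 (by positivity)
    exact pow_eq_zero_iff two_ne_zero |>.1 (le_antisymm h2 (sq_nonneg _))
  · have h1 := hsub r (P s) (hfin s)
    have h2 := hsub s (P r) (hfin r)
    have h3 : n * ((r - P r - (s - P s)) ^ 2) ≤ n * ((r - P r - (s - P s)) * (r - s)) := by
      linarith
    exact le_of_mul_le_mul_left h3 hn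
  · have := hJ0 (P r)
    positivity
  · have h := hminE r 0 (by rw [hj0]; exact ENNReal.zero_ne_top)
    simpa [hJ, hj0] using h
  · have h := hP r r
    rw [sub_self, zero_pow two_ne_zero, mul_zero, ENNReal.ofReal_zero, add_zero] at h
    rwa [ENNReal.ofReal_add (hJ0 _) (by positivity), hJ, ENNReal.ofReal_toReal (hfin r)]
  · have h1 := hsub r (P s) (hfin s)
    have h2 : 0 ≤ n / 2 * ((r - P r) - (s - P s)) ^ 2 := by positivity
    simp only
    linarith
  · rw [ENNReal.ofReal_add (hJ0 _) (by positivity), hJ, ENNReal.ofReal_toReal (hfin r)]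
    exact le_self_add
  · simp only [le_add_iff_nonneg_left]
    exact hJ0 _

theorem continuous_of_subgradient {e q : ℝ → ℝ} (hq : IsFirmContraction q) {n : ℝ}
    (h : ∀ r s, e r + n * (q r * (s - r)) ≤ e s) : Continuous e := by
  refine continuous_iff_continuousAt.2 fun r => ?_
  have hlow : Tendsto (fun s => e r + n * (q r * (s - r))) (𝓝 r) (𝓝 (e r)) := by
    have : Continuous (fun s => e r + n * (q r * (s - r))) := by fun_prop
    simpa using this.tendsto r
  have hup : Tendsto (fun s => e r - n * (q s * (r - s))) (𝓝 r) (𝓝 (e r)) := by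
    have hqc := hq.continuous
    have : Continuous (fun s => e r - n * (q s * (r - s))) := by fun_prop
    simpa using this.tendsto r
  exact tendsto_of_tendsto_of_tendsto_of_le_of_le hlow hup (h r) fun s => by
    have := h s r
    simp only
    linarith

/-- To compare `∫ j(w)` with `∫ j(w + λ d)` for all `j ∈ J₀`, it suffices that `∫ d q(w) ≥ 0` for
all firm contractions `q`: pass to Moreau envelopes and use Fatou's lemma. -/
theorem dominated_of_forall_integral_nonneg {w d : Lp ℝ 2 ν}
    (h : ∀ q, IsFirmContraction q → 0 ≤ ∫ x, d x * q (w x) ∂ν) {lam : ℝ} (hlam : 0 < lam) :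
    Dominated ν w (w + lam • d : Lp ℝ 2 ν) := by
  intro j hj
  have hpos : ∀ n : ℕ, (0 : ℝ) < (n : ℝ) + 1 := fun n => by positivity
  choose e q hq he0 he1 hej hesub heapp using fun n : ℕ => exists_envelope hj (hpos n)
  have hec : ∀ n, Continuous (e n) := fun n => continuous_of_subgradient (hq n) (hesub n)
  set w' : Lp ℝ 2 ν := w + lam • d with hw'
  have hw'ae : ∀ᵐ x ∂ν, w' x = w x + lam * d x := by
    filter_upwards [Lp.coeFn_add w (lam • d), Lp.coeFn_smul lam d] with x h1 h2
    rw [hw', h1, Pi.add_apply, h2, Pi.smul_apply, smul_eq_mul]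
  have hint : ∀ n (v : Lp ℝ 2 ν), Integrable (fun x => e n (v x)) ν := fun n v => by
    refine (((memLp_two_iff_integrable_sq (Lp.memLp v).1).1 (Lp.memLp v)).const_mul
      (((n : ℝ) + 1) / 2)).mono' ((hec n).measurable.comp (measurable_Lp v)).aestronglyMeasurable
      (Eventually.of_forall fun x => ?_)
    rw [Real.norm_of_nonneg (he0 n _)]
    exact he1 n _
  have hle : ∀ n, ∫⁻ x, ENNReal.ofReal (e n (w x)) ∂ν ≤ ∫⁻ x, j (w' x) ∂ν := fun n => by
    have hqint : Integrable (fun x => d x * q n (w x)) ν := by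
      refine (Lp.memLp d).integrable_mul ((Lp.memLp w).mono
        ((hq n).continuous.measurable.comp (measurable_Lp w)).aestronglyMeasurable
        (Eventually.of_forall fun x => ?_))
      exact (hq n).abs_le _
    have h1 : ∫ x, e n (w x) ∂ν ≤ ∫ x, e n (w' x) ∂ν := by
      have h2 : ∫ x, (e n (w x) + ((n : ℝ) + 1) * lam * (d x * q n (w x))) ∂ν
          ≤ ∫ x, e n (w' x) ∂ν := by
        refine integral_mono_ae ((hint n w).add (hqint.const_mul _)) (hint n w') ?_
        filter_upwards [hw'ae] with x hx
        have h3 := hesub n (w x) (w' x)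
        rw [hx] at h3 ⊢
        linarith
      rw [integral_add (hint n w) (hqint.const_mul _), integral_const_mul] at h2
      have h4 := mul_nonneg (mul_nonneg (hpos n).le hlam.le) (h (q n) (hq n))
      linarith
    calc ∫⁻ x, ENNReal.ofReal (e n (w x)) ∂ν
        = ENNReal.ofReal (∫ x, e n (w x) ∂ν) :=
          (ofReal_integral_eq_lintegral_ofReal (hint n w)
            (Eventually.of_forall fun x => he0 n _)).symm
      _ ≤ ENNReal.ofReal (∫ x, e n (w' x) ∂ν) := ENNReal.ofReal_le_ofReal h1
      _ = ∫⁻ x, ENNReal.ofReal (e n (w' x)) ∂ν :=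
          ofReal_integral_eq_lintegral_ofReal (hint n w')
            (Eventually.of_forall fun x => he0 n _)
      _ ≤ ∫⁻ x, j (w' x) ∂ν := lintegral_mono fun x => hej n _
  have hlim : ∀ r, j r ≤ liminf (fun n => ENNReal.ofReal (e n r)) atTop := fun r => by
    refine le_of_forall_lt fun y hy => ?_
    obtain ⟨y', hyy', hy'⟩ := exists_between hy
    refine hyy'.trans_le (le_liminf_of_le (by isBoundedDefault) ?_)
    obtain ⟨δ, hδ, hball⟩ := Metric.eventually_nhds_iff.1 (hj.2.1 r y' hy')
    have hy'top : y' ≠ ∞ := (hy'.trans_le le_top).ne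
    filter_upwards [eventually_ge_atTop ⌈y'.toReal / (δ ^ 2 / 2)⌉₊] with n hn
    obtain ⟨s, hs1, hs2⟩ := heapp n r
    by_cases hs : dist s r < δ
    · exact (hball hs).le.trans hs1
    · have h1 : y'.toReal / (δ ^ 2 / 2) ≤ (n : ℝ) + 1 :=
        (Nat.le_ceil _).trans (by exact_mod_cast hn.trans (Nat.le_succ n))
      rw [div_le_iff₀ (by positivity)] at h1
      have h2 : δ ^ 2 ≤ (r - s) ^ 2 := by
        rw [not_lt, Real.dist_eq, abs_sub_comm] at hs
        rw [← sq_abs (r - s)]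
        exact pow_le_pow_left₀ hδ.le hs 2
      rw [← ENNReal.ofReal_toReal hy'top]
      refine ENNReal.ofReal_le_ofReal ?_
      have h3 := mul_le_mul_of_nonneg_left h2 (by have := hpos n; positivity :
        (0 : ℝ) ≤ ((n : ℝ) + 1) / 2)
      linarith
  calc ∫⁻ x, j (w x) ∂ν ≤ ∫⁻ x, liminf (fun n => ENNReal.ofReal (e n (w x))) atTop ∂ν :=
        lintegral_mono fun x => hlim _
    _ ≤ liminf (fun n => ∫⁻ x, ENNReal.ofReal (e n (w x)) ∂ν) atTop :=
        lintegral_liminf_le fun n =>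
          ((hec n).measurable.comp (measurable_Lp w)).ennreal_ofReal
    _ ≤ liminf (fun _ : ℕ => ∫⁻ x, j (w' x) ∂ν) atTop :=
        liminf_le_liminf (Eventually.of_forall hle)
    _ = ∫⁻ x, j (w' x) ∂ν := liminf_const _

/-! ### Complete accretivity -/

section Accretive

variable [IsMarkovKernel m] [SigmaFinite ν]

omit [IsMarkovKernel m] [SigmaFinite ν] in
/-- Moving `f` and `g` towards each other by `q(f - g)` decreases the sum of their energies. -/
theorem weightedEnergy_sub_add_le {K : X → X → ℝ} (hK : IsSymmWeight K) {p : ℝ} (hp : 1 ≤ p)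
    {f g : X → ℝ} (hf : Measurable f) (hg : Measurable g) {q : ℝ → ℝ} (hq : IsFirmContraction q) :
    weightedEnergy m ν K p (fun x => f x - q (f x - g x))
        + weightedEnergy m ν K p (fun x => g x + q (f x - g x))
      ≤ weightedEnergy m ν K p f + weightedEnergy m ν K p g := by
  have hm : Measurable fun x => f x - q (f x - g x) :=
    hf.sub (hq.continuous.measurable.comp (hf.sub hg))
  simp only [weightedEnergy_eq]
  rw [← mul_add, ← mul_add,
    ← lintegral_add_left (hK.measurable_energyDensity p hm).ennreal_ofReal,
    ← lintegral_add_left (hK.measurable_energyDensity p hf).ennreal_ofReal]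
  refine mul_le_mul_right (lintegral_mono fun y => ?_) _
  have hnn := fun f => hK.energyDensity_nonneg p f y
  rw [← ENNReal.ofReal_add (hnn _) (hnn _), ← ENNReal.ofReal_add (hnn _) (hnn _)]
  refine ENNReal.ofReal_le_ofReal ?_
  obtain ⟨θ, h0, h1, hθ⟩ := hq.exists_eq_mul (f y.2 - g y.2) (f y.1 - g y.1)
  have h := mul_le_mul_of_nonneg_left (abs_rpow_add_abs_rpow_le hp h0 h1
    (a := nonlocalGrad f y.1 y.2) (b := nonlocalGrad g y.1 y.2)
    (c := q (f y.2 - g y.2) - q (f y.1 - g y.1))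
    (by rw [hθ]; simp only [nonlocalGrad]; ring)) (hK.nonneg y.1 y.2)
  have h2 : nonlocalGrad (fun x => f x - q (f x - g x)) y.1 y.2
      = nonlocalGrad f y.1 y.2 - (q (f y.2 - g y.2) - q (f y.1 - g y.1)) := by
    simp only [nonlocalGrad]; ring
  have h3 : nonlocalGrad (fun x => g x + q (f x - g x)) y.1 y.2
      = nonlocalGrad g y.1 y.2 + (q (f y.2 - g y.2) - q (f y.1 - g y.1)) := by
    simp only [nonlocalGrad]; ring
  simp only [energyDensity, h2, h3]
  linarith

omit [SigmaFinite ν] in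
/-- A functional that decreases when two functions are moved towards each other by a firm
contraction of their difference has a completely accretive subdifferential. -/
theorem completelyAccretive_subdifferential {F : Lp ℝ 2 ν → ℝ≥0∞}
    (hF : ∀ q, IsFirmContraction q → ∀ u₁ u₂ w : Lp ℝ 2 ν, (w =ᵐ[ν] fun x => q (u₁ x - u₂ x)) →
      F (u₁ - w) + F (u₂ + w) ≤ F u₁ + F u₂) :
    CompletelyAccretive (subdifferential (fun u => (F u : EReal))) := by
  intro lam hlam u₁ u₂ v₁ v₂ hv₁ hv₂
  refine dominated_of_forall_integral_nonneg (fun q hq => ?_) hlam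
  rw [mem_subdifferential_coe_iff] at hv₁ hv₂
  obtain ⟨hu₁, hv₁⟩ := hv₁
  obtain ⟨hu₂, hv₂⟩ := hv₂
  have hmem : MemLp (fun x => q ((u₁ - u₂ : Lp ℝ 2 ν) x)) 2 ν :=
    (Lp.memLp (u₁ - u₂)).mono
      (hq.continuous.measurable.comp (measurable_Lp _)).aestronglyMeasurable
      (Eventually.of_forall fun x => hq.abs_le _)
  set w := hmem.toLp with hw
  have hwae : w =ᵐ[ν] fun x => q (u₁ x - u₂ x) := by
    filter_upwards [hmem.coeFn_toLp, Lp.coeFn_sub u₁ u₂] with x h1 h2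
    rw [hw, h1, h2, Pi.sub_apply]
  have hle := hF q hq u₁ u₂ w hwae
  have hsum : F u₁ + F u₂ ≠ ∞ := ENNReal.add_ne_top.2 ⟨hu₁, hu₂⟩
  obtain ⟨h1, h2⟩ := ENNReal.add_ne_top.1 (ne_top_of_le_ne_top hsum hle)
  have hle' := ENNReal.toReal_mono hsum hle
  rw [ENNReal.toReal_add h1 h2, ENNReal.toReal_add hu₁ hu₂] at hle'
  have h3 := hv₁ _ h1
  have h4 := hv₂ _ h2
  rw [sub_sub_cancel_left, inner_neg_right] at h3
  rw [add_sub_cancel_left] at h4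
  have h5 : ∫ x, (v₁ - v₂ : Lp ℝ 2 ν) x * q ((u₁ - u₂ : Lp ℝ 2 ν) x) ∂ν
      = inner ℝ (v₁ - v₂) w := by
    rw [inner_Lp_eq]
    refine integral_congr_ae ?_
    filter_upwards [hmem.coeFn_toLp] with x hx
    rw [hw, hx]
  rw [h5, inner_sub_left]
  linarith

theorem completelyAccretive_subdifferential_add (hrev : m.IsReversible ν) {K₁ K₂ : X → X → ℝ}
    (hK₁ : IsSymmWeight K₁) (hK₂ : IsSymmWeight K₂) {p : ℝ} (hp : 1 ≤ p) :
    CompletelyAccretive (subdifferential (fun w : Lp ℝ 2 ν =>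
      ((weightedEnergy m ν K₁ 1 w + weightedEnergy m ν K₂ p w : ℝ≥0∞) : EReal))) := by
  refine completelyAccretive_subdifferential
    (F := fun w : Lp ℝ 2 ν => weightedEnergy m ν K₁ 1 w + weightedEnergy m ν K₂ p w)
    fun q hq u₁ u₂ w hw => ?_
  have h1 : (u₁ - w : Lp ℝ 2 ν) =ᵐ[ν] fun x => u₁ x - q (u₁ x - u₂ x) := by
    filter_upwards [Lp.coeFn_sub u₁ w, hw] with x h2 h3
    rw [h2, Pi.sub_apply, h3]
  have h2 : (u₂ + w : Lp ℝ 2 ν) =ᵐ[ν] fun x => u₂ x + q (u₁ x - u₂ x) := by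
    filter_upwards [Lp.coeFn_add u₂ w, hw] with x h2 h3
    rw [h2, Pi.add_apply, h3]
  simp only [weightedEnergy_congr hrev _ _ h1, weightedEnergy_congr hrev _ _ h2]
  rw [add_add_add_comm, add_add_add_comm (weightedEnergy m ν K₁ 1 u₁)]
  exact add_le_add
    (weightedEnergy_sub_add_le hK₁ le_rfl (measurable_Lp u₁) (measurable_Lp u₂) hq)
    (weightedEnergy_sub_add_le hK₂ hp (measurable_Lp u₁) (measurable_Lp u₂) hq)

end Accretive

end RandomWalk

theorem theorem4p3 {X : Type*} [MeasurableSpace X] [MeasurableSpace.CountablyGenerated X]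
    (m : Kernel X X) [IsMarkovKernel m] (ν : Measure X) [SigmaFinite ν]
    (hrev : m.IsReversible ν)
    (A B : X → Set X)
    (hAmeas : MeasurableSet {q : X × X | q.2 ∈ A q.1})
    (hBmeas : MeasurableSet {q : X × X | q.2 ∈ B q.1})
    (hA : ∀ x, m x (A x) ≠ 0) (hB : ∀ x, m x (B x) ≠ 0)
    (hcover : ∀ x, m x (A x ∪ B x)ᶜ = 0)
    (p : ℝ) (hp : 1 < p) (hcond : ν Set.univ < ∞ ∨ 2 ≤ p) :
    RandomWalk.subdifferential (RandomWalk.energy m ν A 1 + RandomWalk.energy m ν B p)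
        = RandomWalk.subdifferential (RandomWalk.energy m ν A 1)
          + RandomWalk.subdifferential (RandomWalk.energy m ν B p) ∧
      RandomWalk.subdifferential (RandomWalk.energy m ν A 1)
          + RandomWalk.subdifferential (RandomWalk.energy m ν B p)
        = -RandomWalk.oneLaplacian m ν A - RandomWalk.pLaplacian m ν B p ∧
      RandomWalk.CompletelyAccretive
        (RandomWalk.subdifferential (RandomWalk.energy m ν A 1 + RandomWalk.energy m ν B p)) ∧
      Dense (RandomWalk.opDomain
        (RandomWalk.subdifferential
          (RandomWalk.energy m ν A 1 + RandomWalk.energy m ν B p))) := by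
  have hKA := RandomWalk.isSymmWeight_symWeight hAmeas
  have hKB := RandomWalk.isSymmWeight_symWeight hBmeas
  have hsum : RandomWalk.energy m ν A 1 + RandomWalk.energy m ν B p
      = fun w : Lp ℝ 2 ν => ((RandomWalk.weightedEnergy m ν (RandomWalk.symWeight A) 1 w
        + RandomWalk.weightedEnergy m ν (RandomWalk.symWeight B) p w : ℝ≥0∞) : EReal) := by
    ext w
    rw [EReal.coe_ennreal_add]
    rfl
  have hone : -RandomWalk.oneLaplacian m ν A
      = RandomWalk.subdifferential (RandomWalk.energy m ν A 1) := by
    ext u v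
    simp [RandomWalk.oneLaplacian]
  have hpl : -RandomWalk.pLaplacian m ν B p
      = RandomWalk.subdifferential (RandomWalk.energy m ν B p) := by
    ext u v
    have h := RandomWalk.mem_subdifferential_weightedEnergy_iff hrev hKB hp (u := u) (v := v)
    refine Iff.trans ?_ h.symm
    rw [Pi.neg_apply, Set.mem_neg]
    refine and_congr_right fun _ => ?_
    simp_rw [RandomWalk.mDiv_mul_signedPow hKB]
    constructor <;> intro h1 <;> filter_upwards [h1, Lp.coeFn_neg v] with x h2 h3
    · rw [h3, Pi.neg_apply] at h2
      linarith
    · rw [h3, Pi.neg_apply, h2, neg_neg]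
  refine ⟨?_, ?_, ?_, ?_⟩
  · rw [hsum]
    ext u v
    rw [Pi.add_apply, Set.mem_add]
    refine ⟨fun hv =>
      RandomWalk.exists_add_of_mem_subdifferential_add hrev hKA hKB hp hcond hv, ?_⟩
    rintro ⟨v₁, hv₁, v₂, hv₂, rfl⟩
    exact RandomWalk.add_subset_subdifferential_add hv₁ hv₂
  · rw [sub_eq_add_neg, hone, hpl]
  · rw [hsum]
    exact RandomWalk.completelyAccretive_subdifferential_add hrev hKA hKB hp.le
  · rw [hsum]
    exact RandomWalk.dense_opDomain_subdifferential_add hrev hKA hKB hp
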